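/- Let $k$ be an algebraically closed field, $q\in k\setminus\{0\}$ and $m\in\mathbb Z$. Assume $q^4\neq 1$, and put $\lambda_1=\frac{q^m}{q-q^{-1}}$, $\lambda_2=\frac{q^{-m}}{q-q^{-1}}$, $[a]=\frac{q^a-q^{-a}}{q-q^{-1}}$; assume also $\lambda_1\ne\lambda_2$ and $\lambda_1\neq q^2\lambda_2$. For $n\ge 1$ the blob algebra $b_n=b_n(q,m)$ is the unital $k$-algebra with generators $U_0,\dots,U_{n-1}$ and relations $U_i^2=-[2]U_i$ for $i\ge1$, $U_0^2=-[m]U_0$, $U_1U_0U_1=[m-1]U_1$, $U_iU_jU_i=U_i$ for $i,j\geq 1$ with $|i-j|=1$, and $U_iU_j=U_jU_i$ for $|i-j|\ge2$. Let $V$ have basis $v_1,v_2$, and let $R$ be the operator on $V\otimes V$ with $R(v_i\otimes v_i)=q\,v_i\otimes v_i$, $R(v_2\otimes v_1)=v_1\otimes v_2$, $R(v_1\otimes v_2)=v_2\otimes v_1+(q-q^{-1})v_1\otimes v_2$. For $2\le j\le n$ let $T_j$ be $R$ acting on the tensor factors $j-1,j$ of $V^{\otimes n}$, and let $S_j$ multiply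 a basis tensor by $q$ if its factors $j-1,j$ agree and exchange these two factors otherwise. Let $\varpi$ multiply a basis tensor by $\lambda_1$ or $\lambda_2$ according as its first factor is $v_1$ or $v_2$, and let $T_1=T_2^{-1}\cdots T_n^{-1}S_n\cdots S_2\varpi$. Then $V^{\otimes n}$ is a $b_n$-module, $U_0$ acting as $T_1-\lambda_1$ and $U_i$ ($i\ge1$) as $T_{i+1}-q$. For $\lambda=n_1-n_2$ with $n_1+n_2=n$, $n_1,n_2\ge0$, let $M_n(\lambda)\subseteq V^{\otimes n}$ be the $b_n$-submodule spanned by the basis tensors with $n_1$ factors $v_1$ and $n_2$ factors $v_2$. For $n\geq 2$ let $e=-[2]^{-1}U_{n-1}$, an idempotent of $b_n$; let $F N=eN$ be the localization functor from $b_n$-modules to $eb_ne$-modules, $G N=b_ne\otimes_{eb_ne}N$ its left adjoint (globalization), and $\varphi_\lambda:G F M_n(\lambda)\to M_n(\lambda)$, $x\otimes y\mapsto xy$, the adjointness map. Finally let $\Delta_n(\lambda)$ be the standard module, that is, $b_nu$ with $u=U_{n-1}U_{n-3}\cdots U_{|\lambda|+1}$, modulo the $b_n$-submodule generated by $U_iu$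 for $0<i<|\lambda|$ and, if $\lambda\neq0$, by $U_0u-cu$, where $c=0$ for $\lambda>0$ and $c=-[m]$ for $\lambda<0$. Let $n\ge3$. **(1)** Suppose that $q$ is a primitive $l$-th root of unity with $l$ odd, and let $\lambda=n_1-n_2$ with $n_1+n_2=n$ and $\lambda\neq\pm n$. Then a) $\varphi_\lambda$ is surjective if and only if $n_2\not\equiv m \pmod l$; b) $\varphi_\lambda$ is injective if and only if $n_2\not\equiv m \pmod l$; c) $\varphi_\lambda$ is an isomorphism if and only if $n_2\not\equiv m \pmod l$. Moreover, if $n_2\equiv m\pmod l$, then $G F M_n(\lambda)\not\cong M_n(\lambda)$ and $M_n(\lambda)\not\cong\Delta_n(\lambda)$ as $b_n$-modules. **(2)** The exceptional case does occur: for every algebraically closed field $k$ and every $n\geq3$ there are $q,m,l,\lambda$ as in (1), with $n_2\equiv m\pmod l$, so that $G F M_n(\lambda)\not\cong M_n(\lambda)$ and $M_n(\lambda)\not\cong\Delta_n(\lambda)$. -/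

import Mathlib

open scoped TensorProduct

noncomputable section

/-! ## The blob algebra -/

/-- The Gaussian integer `[a] = (q ^ a - q ^ (-a)) / (q - q⁻¹)`. -/
def gaussInt {k : Type*} [Field k] (q : k) (a : ℤ) : k :=
  (q ^ a - q ^ (-a)) / (q - q⁻¹)

/-- The parameters `q ∈ k`, `m ∈ ℤ` with their standing assumptions: `q ≠ 0`, `q ^ 4 ≠ 1`,
`λ₁ ≠ λ₂` and `λ₁ ≠ q² λ₂`, where `λ₁ = q ^ m / (q - q⁻¹)` and `λ₂ = q ^ (-m) / (q - q⁻¹)`. -/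
structure BlobParams (k : Type*) [Field k] where
  q : k
  m : ℤ
  q_ne_zero : q ≠ 0
  q_pow_four_ne_one : q ^ 4 ≠ 1
  lam_ne : q ^ m / (q - q⁻¹) ≠ q ^ (-m) / (q - q⁻¹)
  lam_ne_mul : q ^ m / (q - q⁻¹) ≠ q ^ 2 * (q ^ (-m) / (q - q⁻¹))

namespace BlobParams

variable {k : Type*} [Field k] (P : BlobParams k)

/-- `λ₁`. -/
def lam₁ : k := P.q ^ P.m / (P.q - P.q⁻¹)

/-- `λ₂`. -/
def lam₂ : k := P.q ^ (-P.m) / (P.q - P.q⁻¹)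

lemma q_sub_ne_zero : P.q - P.q⁻¹ ≠ 0 := by
  intro h
  have h0 := P.q_ne_zero
  have h1 : P.q * P.q = 1 := by
    have : P.q = P.q⁻¹ := sub_eq_zero.mp h
    nth_rewrite 2 [this]
    exact mul_inv_cancel₀ h0
  apply P.q_pow_four_ne_one
  linear_combination (P.q * P.q + 1) * h1

lemma gaussInt_two : gaussInt P.q 2 = P.q + P.q⁻¹ := by
  have h0 := P.q_ne_zero
  have h := P.q_sub_ne_zero
  unfold gaussInt
  rw [div_eq_iff h, zpow_neg, zpow_ofNat]
  field_simp
  ring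

lemma gaussInt_two_ne_zero : gaussInt P.q 2 ≠ 0 := by
  have h0 := P.q_ne_zero
  rw [P.gaussInt_two]
  intro h
  have h1 : P.q * P.q = -1 := by
    have : P.q = -P.q⁻¹ := eq_neg_of_add_eq_zero_left h
    nth_rewrite 2 [this]
    rw [mul_neg, mul_inv_cancel₀ h0]
  apply P.q_pow_four_ne_one
  linear_combination (P.q * P.q - 1) * h1

lemma lam_sub : P.lam₂ - P.lam₁ = -gaussInt P.q P.m := by
  unfold lam₁ lam₂ gaussInt
  ring

lemma lam_comb : P.lam₁ * P.q⁻¹ - P.lam₂ * P.q = gaussInt P.q (P.m - 1) := by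
  have h0 := P.q_ne_zero
  unfold lam₁ lam₂ gaussInt
  rw [neg_sub, zpow_sub₀ h0, zpow_sub₀ h0, zpow_neg, zpow_one]
  ring

end BlobParams

/-- The defining relations of the blob algebra on generators `U 0, …, U (n - 1)`. -/
inductive BlobRel {k : Type*} [Field k] (P : BlobParams k) (n : ℕ) :
    FreeAlgebra k (Fin n) → FreeAlgebra k (Fin n) → Prop
  | sq (i : Fin n) (hi : 0 < i.val) :
      BlobRel P n (FreeAlgebra.ι k i * FreeAlgebra.ι k i)
        (-gaussInt P.q 2 • FreeAlgebra.ι k i)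
  | sq_zero (i : Fin n) (hi : i.val = 0) :
      BlobRel P n (FreeAlgebra.ι k i * FreeAlgebra.ι k i)
        (-gaussInt P.q P.m • FreeAlgebra.ι k i)
  | one_zero_one (i j : Fin n) (hi : i.val = 1) (hj : j.val = 0) :
      BlobRel P n (FreeAlgebra.ι k i * FreeAlgebra.ι k j * FreeAlgebra.ι k i)
        (gaussInt P.q (P.m - 1) • FreeAlgebra.ι k i)
  | adjacent (i j : Fin n) (hi : 0 < i.val) (hj : 0 < j.val)
      (h : i.val + 1 = j.val ∨ j.val + 1 = i.val) :
      BlobRel P n (FreeAlgebra.ι k i * FreeAlgebra.ι k j * FreeAlgebra.ι k i)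
        (FreeAlgebra.ι k i)
  | far (i j : Fin n) (h : i.val + 2 ≤ j.val) :
      BlobRel P n (FreeAlgebra.ι k i * FreeAlgebra.ι k j)
        (FreeAlgebra.ι k j * FreeAlgebra.ι k i)

/-- The blob algebra `b_n = b_n(q, m)`. -/
def Blob {k : Type*} [Field k] (P : BlobParams k) (n : ℕ) : Type _ :=
  RingQuot (BlobRel P n)

namespace Blob

variable {k : Type*} [Field k] (P : BlobParams k)

instance (n : ℕ) : Ring (Blob P n) := inferInstanceAs (Ring (RingQuot (BlobRel P n)))

instance (n : ℕ) : Algebra k (Blob P n) := inferInstanceAs (Algebra k (RingQuot (BlobRel P n)))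

/-- The quotient map from the free algebra. -/
def mk (n : ℕ) : FreeAlgebra k (Fin n) →ₐ[k] Blob P n :=
  RingQuot.mkAlgHom k (BlobRel P n)

lemma mk_surjective (n : ℕ) : Function.Surjective (mk P n) :=
  RingQuot.mkAlgHom_surjective k (BlobRel P n)

lemma mk_rel {n : ℕ} {x y : FreeAlgebra k (Fin n)} (h : BlobRel P n x y) : mk P n x = mk P n y :=
  RingQuot.mkAlgHom_rel k h

/-- The generator `U_i` of the blob algebra. -/
def U {n : ℕ} (i : Fin n) : Blob P n := mk P n (FreeAlgebra.ι k i)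

/-- Representations of the blob algebra from operators satisfying the relations. -/
def lift {n : ℕ} {A : Type*} [Ring A] [Algebra k A] (f : FreeAlgebra k (Fin n) →ₐ[k] A)
    (hf : ∀ ⦃x y⦄, BlobRel P n x y → f x = f y) : Blob P n →ₐ[k] A :=
  RingQuot.liftAlgHom k ⟨f, hf⟩

lemma lift_mk {n : ℕ} {A : Type*} [Ring A] [Algebra k A] (f : FreeAlgebra k (Fin n) →ₐ[k] A)
    (hf : ∀ ⦃x y⦄, BlobRel P n x y → f x = f y) (x : FreeAlgebra k (Fin n)) :
    lift P f hf (mk P n x) = f x :=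
  RingQuot.liftAlgHom_mkAlgHom_apply k f hf x

end Blob

/-! ## The tensor space -/

namespace ATY

variable {k : Type*} [Field k] (P : BlobParams k) {n : ℕ}

/-- Words of length `n` in two letters; the letter `0` stands for `v₁`, the letter `1` for `v₂`. -/
abbrev Word (n : ℕ) : Type := Fin n → Fin 2

/-- The tensor space `V^{⊗ n}`, for `V` with basis `v₁, v₂`, as the free `k`-module on the words of
length `n`. -/
def TensorSpace {k : Type*} [Field k] (_P : BlobParams k) (n : ℕ) : Type _ := Word n →₀ k

instance : AddCommGroup (TensorSpace P n) := inferInstanceAs (AddCommGroup (Word n →₀ k))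

instance : Module k (TensorSpace P n) := inferInstanceAs (Module k (Word n →₀ k))

/-- The basis vector `v_{s 0} ⊗ ⋯ ⊗ v_{s (n - 1)}`. -/
def vec (s : Word n) : TensorSpace P n := (Finsupp.single s 1 : Word n →₀ k)

/-- The words form a basis of the tensor space. -/
def wordBasis (n : ℕ) : Module.Basis (Word n) k (TensorSpace P n) :=
  Module.Basis.ofRepr (LinearEquiv.refl k (Word n →₀ k))

lemma wordBasis_apply (s : Word n) : wordBasis P n s = vec P s := rfl

/-- The linear operator with prescribed values on the words. -/
def ofWords (f : Word n → TensorSpace P n) : Module.End k (TensorSpace P n) :=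
  (wordBasis P n).constr k f

lemma ofWords_vec (f : Word n → TensorSpace P n) (s : Word n) : ofWords P f (vec P s) = f s := by
  rw [← wordBasis_apply]
  exact (wordBasis P n).constr_basis k f s

lemma ext_vec {f g : Module.End k (TensorSpace P n)}
    (h : ∀ s : Word n, f (vec P s) = g (vec P s)) : f = g :=
  (wordBasis P n).ext h

/-- The position before `i` (only used for `i ≠ 0`). -/
def prev (i : Fin n) : Fin n := ⟨i.val - 1, by omega⟩

/-- Exchange of the letters at the positions `i - 1` and `i`. -/
def swapW (i : Fin n) (s : Word n) : Word n := s ∘ Equiv.swap (prev i) i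

/-- The operator `T_{i+1}`: the matrix `R` at the (zero-based) positions `i - 1` and `i`. -/
def T (i : Fin n) : Module.End k (TensorSpace P n) :=
  ofWords P fun s : Word n =>
    if s (prev i) = s i then P.q • vec P s
    else if s (prev i) = 1 then vec P (swapW i s)
    else vec P (swapW i s) + (P.q - P.q⁻¹) • vec P s

/-- The operator `S_{i+1}`, acting at the (zero-based) positions `i - 1` and `i`. -/
def S (i : Fin n) : Module.End k (TensorSpace P n) :=
  ofWords P fun s : Word n =>
    if s (prev i) = s i then P.q • vec P s
    else vec P (swapW i s)

/-- The operator `ϖ`: multiplication by `λ₁` or `λ₂` according to the first letter. -/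
def varpi [NeZero n] : Module.End k (TensorSpace P n) :=
  ofWords P fun s : Word n =>
    (if s 0 = 0 then P.lam₁ else P.lam₂) • vec P s

/-- Operators at the positions `i - 1` and `i` of a general shape. -/
def loc (α β : Fin 2 → Fin 2 → k) (i : Fin n) : Module.End k (TensorSpace P n) :=
  ofWords P fun s : Word n =>
    α (s (prev i)) (s i) • vec P s +
      β (s (prev i)) (s i) • vec P (swapW i s)

lemma loc_vec (α β : Fin 2 → Fin 2 → k) (i : Fin n) (s : Word n) :
    loc P α β i (vec P s) = α (s (prev i)) (s i) • vec P s +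
      β (s (prev i)) (s i) • vec P (swapW i s) :=
  ofWords_vec P _ s

lemma T_eq (i : Fin n) : T P i = loc P
    (fun x y => if x = y then P.q else if x = 1 then 0 else P.q - P.q⁻¹)
    (fun x y => if x = y then 0 else 1) i := by
  unfold T loc
  congr 1
  funext s
  beta_reduce
  split_ifs <;> simp [add_comm]

lemma S_eq (i : Fin n) : S P i = loc P
    (fun x y => if x = y then P.q else 0)
    (fun x y => if x = y then 0 else 1) i := by
  unfold S loc
  congr 1
  funext s
  beta_reduce
  split_ifs <;> simp

lemma prev_val (i : Fin n) : (prev i).val = i.val - 1 := rfl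

lemma swapW_apply (i : Fin n) (s : Word n) (j : Fin n) :
    swapW i s j = if j = prev i then s i else if j = i then s (prev i) else s j := by
  simp only [swapW, Function.comp, Equiv.swap_apply_def]
  split_ifs <;> rfl

lemma swapW_of_ne (i : Fin n) (s : Word n) (j : Fin n) (h1 : j ≠ prev i) (h2 : j ≠ i) :
    swapW i s j = s j := by
  rw [swapW_apply, if_neg h1, if_neg h2]

lemma swapW_left (i : Fin n) (s : Word n) : swapW i s (prev i) = s i := by
  simp [swapW]

lemma swapW_right (i : Fin n) (s : Word n) : swapW i s i = s (prev i) := by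
  simp [swapW]

lemma swapW_swapW (i : Fin n) (s : Word n) : swapW i (swapW i s) = s := by
  funext j
  simp [swapW]

lemma loc_comm (α β α' β' : Fin 2 → Fin 2 → k) (i j : Fin n) (hi : 0 < i.val)
    (h : i.val + 2 ≤ j.val) : loc P α β i * loc P α' β' j = loc P α' β' j * loc P α β i := by
  have hij : j ≠ i := fun e => by subst e; omega
  have hpij : prev j ≠ i := fun e => by have := congrArg Fin.val e; simp [prev] at this; omega
  have hjpi : j ≠ prev i := fun e => by have := congrArg Fin.val e; simp [prev] at this; omega
  have hpp : prev j ≠ prev i := fun e => by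
    have := congrArg Fin.val e; simp [prev] at this; omega
  have hsw : ∀ s : Word n, swapW i (swapW j s) = swapW j (swapW i s) := by
    intro s
    funext x
    simp only [swapW_apply]
    have h1 := hij.symm
    have h2 := hpij.symm
    have h3 := hjpi.symm
    have h4 := hpp.symm
    split_ifs <;> simp_all
  apply ext_vec P
  intro s
  simp only [Module.End.mul_apply, loc_vec P, map_add, map_smul,
    swapW_of_ne j s i hpij.symm hij.symm, swapW_of_ne j s (prev i) hpp.symm hjpi.symm,
    swapW_of_ne i s j hjpi hij, swapW_of_ne i s (prev j) hpp hpij, hsw]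
  module

/-- The word `s` with the letters at `a, b, c` replaced by `x, y, z`. -/
def fr (s : Word n) (a b c : Fin n) (x y z : Fin 2) : Word n :=
  fun t => if t = a then x else if t = b then y else if t = c then z else s t

lemma fr_self (s : Word n) (a b c : Fin n) : fr s a b c (s a) (s b) (s c) = s := by
  funext t
  unfold fr
  split_ifs <;> simp_all

set_option linter.unusedSimpArgs false in
lemma loc_fr_left (α β : Fin 2 → Fin 2 → k) (i j : Fin n) (hi : 0 < i.val)
    (hj : j.val = i.val + 1) (s : Word n) (x y z : Fin 2) :
    loc P α β i (vec P (fr s (prev i) i j x y z)) =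
      α x y • vec P (fr s (prev i) i j x y z) +
      β x y • vec P (fr s (prev i) i j y x z) := by
  have h1 : i ≠ prev i := fun e => by have := congrArg Fin.val e; simp [prev] at this; omega
  have h2 : j ≠ prev i := fun e => by have := congrArg Fin.val e; simp [prev] at this; omega
  have h3 : j ≠ i := fun e => by have := congrArg Fin.val e; omega
  have h4 : swapW i (fr s (prev i) i j x y z) = fr s (prev i) i j y x z := by
    funext t
    rw [swapW_apply]
    unfold fr
    by_cases e1 : t = prev i
    · subst e1; simp [h1, h2, h3, h1.symm, h2.symm, h3.symm]
    by_cases e2 : t = i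
    · subst e2; simp [h1, h2, h3, h1.symm, h2.symm, h3.symm]
    by_cases e3 : t = j
    · subst e3; simp [h1, h2, h3, h1.symm, h2.symm, h3.symm]
    simp [e1, e2, e3]
  rw [loc_vec P, h4]
  simp [fr, h1]

set_option linter.unusedSimpArgs false in
lemma loc_fr_right (α β : Fin 2 → Fin 2 → k) (i j : Fin n) (hi : 0 < i.val)
    (hj : j.val = i.val + 1) (s : Word n) (x y z : Fin 2) :
    loc P α β j (vec P (fr s (prev i) i j x y z)) =
      α y z • vec P (fr s (prev i) i j x y z) +
      β y z • vec P (fr s (prev i) i j x z y) := by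
  have h1 : i ≠ prev i := fun e => by have := congrArg Fin.val e; simp [prev] at this; omega
  have h2 : j ≠ prev i := fun e => by have := congrArg Fin.val e; simp [prev] at this; omega
  have h3 : j ≠ i := fun e => by have := congrArg Fin.val e; omega
  have h0 : prev j = i := by apply Fin.ext; simp [prev]; omega
  have h4 : swapW j (fr s (prev i) i j x y z) = fr s (prev i) i j x z y := by
    funext t
    rw [swapW_apply, h0]
    unfold fr
    by_cases e1 : t = prev i
    · subst e1; simp [h1, h2, h3, h1.symm, h2.symm, h3.symm]
    by_cases e2 : t = i
    · subst e2; simp [h1, h2, h3, h1.symm, h2.symm, h3.symm]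
    by_cases e3 : t = j
    · subst e3; simp [h1, h2, h3, h1.symm, h2.symm, h3.symm]
    simp [e1, e2, e3]
  rw [loc_vec P, h4, h0]
  simp [fr, h1, h2, h3]

lemma T_quad (i : Fin n) (hi : 0 < i.val) :
    T P i * T P i = (P.q - P.q⁻¹) • T P i + 1 := by
  have h1 : i ≠ prev i := fun e => by have := congrArg Fin.val e; simp [prev] at this; omega
  have h0 := P.q_ne_zero
  rw [T_eq]
  apply ext_vec P
  intro s
  simp only [Module.End.mul_apply, loc_vec P, map_add, map_smul, LinearMap.add_apply,
    LinearMap.smul_apply, Module.End.one_apply, swapW_left, swapW_right, swapW_swapW]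
  generalize s (prev i) = x
  generalize s i = y
  fin_cases x <;> fin_cases y <;> simp <;> match_scalars <;> field_simp <;> ring

/-- `T_{i+1}` as an invertible operator. -/
def Tu (i : Fin n) (hi : 0 < i.val) : (Module.End k (TensorSpace P n))ˣ where
  val := T P i
  inv := T P i - (P.q - P.q⁻¹) • 1
  val_inv := by
    rw [mul_sub, T_quad P i hi, mul_smul_comm, mul_one]
    abel
  inv_val := by
    rw [sub_mul, T_quad P i hi, smul_mul_assoc, one_mul]
    abel

lemma T_same (i : Fin n) (s : Word n) (h : s (prev i) = s i) :
    T P i (vec P s) = P.q • vec P s := by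
  unfold T
  rw [ofWords_vec, if_pos h]

lemma T_one_zero (i : Fin n) (s : Word n) (h1 : s (prev i) = 1) (h2 : s i = 0) :
    T P i (vec P s) = vec P (swapW i s) := by
  unfold T
  rw [ofWords_vec, if_neg (by simp [h1, h2]), if_pos h1]

lemma T_zero_one (i : Fin n) (s : Word n) (h1 : s (prev i) = 0) (h2 : s i = 1) :
    T P i (vec P s) = vec P (swapW i s) + (P.q - P.q⁻¹) • vec P s := by
  unfold T
  rw [ofWords_vec, if_neg (by simp [h1, h2]), if_neg (by simp [h1])]

lemma S_same (i : Fin n) (s : Word n) (h : s (prev i) = s i) :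
    S P i (vec P s) = P.q • vec P s := by
  unfold S
  rw [ofWords_vec, if_pos h]

lemma S_ne (i : Fin n) (s : Word n) (h : s (prev i) ≠ s i) :
    S P i (vec P s) = vec P (swapW i s) := by
  unfold S
  rw [ofWords_vec, if_neg h]

/-- The inverse of `T_{i+1}`. -/
def Tinv (i : Fin n) : Module.End k (TensorSpace P n) := Ring.inverse (T P i)

lemma Tinv_eq_unit (i : Fin n) (hi : 0 < i.val) : Tinv P i = ((Tu P i hi)⁻¹ : (Module.End k _)ˣ) :=
  Ring.inverse_unit (Tu P i hi)

lemma Tinv_eq (i : Fin n) (hi : 0 < i.val) : Tinv P i = T P i - (P.q - P.q⁻¹) • 1 :=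
  Tinv_eq_unit P i hi

lemma Tinv_same (i : Fin n) (hi : 0 < i.val) (s : Word n) (h : s (prev i) = s i) :
    Tinv P i (vec P s) = P.q⁻¹ • vec P s := by
  rw [Tinv_eq P i hi, LinearMap.sub_apply, T_same P i s h, LinearMap.smul_apply,
    Module.End.one_apply]
  module

lemma Tinv_zero_one (i : Fin n) (hi : 0 < i.val) (s : Word n) (h1 : s (prev i) = 0)
    (h2 : s i = 1) : Tinv P i (vec P s) = vec P (swapW i s) := by
  rw [Tinv_eq P i hi, LinearMap.sub_apply, T_zero_one P i s h1 h2, LinearMap.smul_apply,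
    Module.End.one_apply]
  module

lemma Tinv_one_zero (i : Fin n) (hi : 0 < i.val) (s : Word n) (h1 : s (prev i) = 1)
    (h2 : s i = 0) :
    Tinv P i (vec P s) = vec P (swapW i s) - (P.q - P.q⁻¹) • vec P s := by
  rw [Tinv_eq P i hi, LinearMap.sub_apply, T_one_zero P i s h1 h2, LinearMap.smul_apply,
    Module.End.one_apply]

/-- The operators `T_{a+1}⁻¹ ⋯ T_{b+1}⁻¹ S_{b+1} ⋯ S_{a+1}` for a list `a, …, b`. -/
def sand (l : List (Fin n)) : Module.End k (TensorSpace P n) :=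
  (l.map (Tinv P)).prod * (l.reverse.map (S P)).prod

lemma sand_nil : sand P ([] : List (Fin n)) = 1 := by simp [sand]

lemma sand_cons (a : Fin n) (l : List (Fin n)) :
    sand P (a :: l) = Tinv P a * sand P l * S P a := by
  simp [sand, mul_assoc]

/-- The operator `T_1 = T_2⁻¹ ⋯ T_n⁻¹ S_n ⋯ S_2 ϖ`, by which `X` acts. -/
def X [NeZero n] : Module.End k (TensorSpace P n) :=
  ((List.finRange n).tail.map (Tinv P)).prod * ((List.finRange n).tail.reverse.map (S P)).prod *
    varpi P

/-- The partial products of `X`. -/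
def C (n a : ℕ) : Module.End k (TensorSpace P n) := sand P ((List.finRange n).drop a)

lemma X_eq [NeZero n] : X P (n := n) = C P n 1 * varpi P := by
  simp [X, C, sand]

lemma C_step (a : ℕ) (h : a < n) : C P n a = Tinv P ⟨a, h⟩ * C P n (a + 1) * S P ⟨a, h⟩ := by
  unfold C
  rw [List.drop_eq_getElem_cons (by simpa using h), sand_cons]
  simp

lemma C_end (a : ℕ) (h : n ≤ a) : C P n a = 1 := by
  unfold C
  rw [List.drop_eq_nil_of_le (by simpa using h), sand_nil]

lemma TT_comm (i j : Fin n) (hi : 0 < i.val) (h : i.val + 2 ≤ j.val) :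
    Commute (T P i) (T P j) := by
  rw [T_eq, T_eq]
  exact loc_comm P _ _ _ _ i j hi h

lemma TS_comm (i j : Fin n) (hi : 0 < i.val) (h : i.val + 2 ≤ j.val) :
    Commute (T P i) (S P j) := by
  rw [T_eq, S_eq]
  exact loc_comm P _ _ _ _ i j hi h

lemma TS_comm' (i j : Fin n) (hi : 0 < i.val) (h : i.val + 2 ≤ j.val) :
    Commute (T P j) (S P i) := by
  rw [T_eq, S_eq]
  exact (loc_comm P _ _ _ _ i j hi h).symm

lemma comm_Tinv {f : Module.End k (TensorSpace P n)} (i : Fin n) (hi : 0 < i.val)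
    (h : Commute f (T P i)) : Commute f (Tinv P i) := by
  rw [Tinv_eq P i hi]
  exact h.sub_right ((Commute.one_right _).smul_right _)

lemma T_sand_comm (j : Fin n) (hj : 0 < j.val) (l : List (Fin n))
    (hl : ∀ a ∈ l, j.val + 2 ≤ a.val) : Commute (T P j) (sand P l) := by
  induction l with
  | nil => rw [sand_nil]; exact Commute.one_right _
  | cons a l ih =>
    rw [sand_cons]
    have ha := hl a (by simp)
    exact ((comm_Tinv P a (by omega) (TT_comm P j a hj ha)).mul_right
      (ih fun b hb => hl b (by simp [hb]))).mul_right (TS_comm P j a hj ha)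

lemma le_of_mem_drop (a : ℕ) (x : Fin n) (h : x ∈ (List.finRange n).drop a) : a ≤ x.val := by
  obtain ⟨i, hi, rfl⟩ := List.getElem_of_mem h
  simp

lemma T_C_far (j : Fin n) (hj : 0 < j.val) (a : ℕ) (h : j.val + 2 ≤ a) :
    Commute (T P j) (C P n a) :=
  T_sand_comm P j hj _ fun x hx => h.trans (le_of_mem_drop a x hx)

/-- The Temperley-Lieb generator `T_{i+1} - q`. -/
def E (i : Fin n) : Module.End k (TensorSpace P n) := T P i - P.q • 1

lemma E_eq (i : Fin n) : E P i = loc P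
    (fun x y => if x = y then 0 else if x = 1 then -P.q else -P.q⁻¹)
    (fun x y => if x = y then 0 else 1) i := by
  unfold E
  rw [T_eq]
  apply ext_vec P
  intro s
  rw [LinearMap.sub_apply, LinearMap.smul_apply, Module.End.one_apply, loc_vec P, loc_vec P]
  split_ifs <;> module

lemma E_sq (i : Fin n) (hi : 0 < i.val) : E P i * E P i = -gaussInt P.q 2 • E P i := by
  have h0 := P.q_ne_zero
  unfold E
  rw [sub_mul, mul_sub, mul_sub, T_quad P i hi, P.gaussInt_two]
  simp only [smul_mul_assoc, mul_smul_comm, mul_one, one_mul]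
  match_scalars <;> field_simp <;> ring

lemma E_left (i j : Fin n) (hi : 0 < i.val) (hj : j.val = i.val + 1) :
    E P i * E P j * E P i = E P i := by
  have h0 := P.q_ne_zero
  rw [E_eq, E_eq]
  apply ext_vec P
  intro s
  rw [← fr_self s (prev i) i j]
  generalize s (prev i) = x
  generalize s i = y
  generalize s j = z
  simp only [Module.End.mul_apply, loc_fr_left P _ _ i j hi hj, loc_fr_right P _ _ i j hi hj,
    map_add, map_smul]
  fin_cases x <;> fin_cases y <;> fin_cases z <;> simp <;> match_scalars <;> field_simp

lemma E_right (i j : Fin n) (hi : 0 < i.val) (hj : j.val = i.val + 1) :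
    E P j * E P i * E P j = E P j := by
  have h0 := P.q_ne_zero
  rw [E_eq, E_eq]
  apply ext_vec P
  intro s
  rw [← fr_self s (prev i) i j]
  generalize s (prev i) = x
  generalize s i = y
  generalize s j = z
  simp only [Module.End.mul_apply, loc_fr_left P _ _ i j hi hj, loc_fr_right P _ _ i j hi hj,
    map_add, map_smul]
  fin_cases x <;> fin_cases y <;> fin_cases z <;> simp <;> match_scalars <;> field_simp

lemma T_braid (i j : Fin n) (hi : 0 < i.val) (hj : j.val = i.val + 1) :
    T P j * T P i * T P j = T P i * T P j * T P i := by
  have h0 := P.q_ne_zero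
  rw [T_eq, T_eq]
  apply ext_vec P
  intro s
  rw [← fr_self s (prev i) i j]
  generalize s (prev i) = x
  generalize s i = y
  generalize s j = z
  simp only [Module.End.mul_apply, loc_fr_left P _ _ i j hi hj, loc_fr_right P _ _ i j hi hj,
    map_add, map_smul]
  fin_cases x <;> fin_cases y <;> fin_cases z <;> simp <;> match_scalars <;> field_simp <;> ring

lemma TSS (i j : Fin n) (hi : 0 < i.val) (hj : j.val = i.val + 1) :
    T P i * S P j * S P i = S P j * S P i * T P j := by
  have h0 := P.q_ne_zero
  rw [T_eq, T_eq, S_eq, S_eq]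
  apply ext_vec P
  intro s
  rw [← fr_self s (prev i) i j]
  generalize s (prev i) = x
  generalize s i = y
  generalize s j = z
  simp only [Module.End.mul_apply, loc_fr_left P _ _ i j hi hj, loc_fr_right P _ _ i j hi hj,
    map_add, map_smul]
  fin_cases x <;> fin_cases y <;> fin_cases z <;> simp <;> match_scalars <;> field_simp

lemma TTT_inv (i j : Fin n) (hi : 0 < i.val) (hj : j.val = i.val + 1) :
    T P j * Tinv P i * Tinv P j = Tinv P i * Tinv P j * T P i := by
  have hj0 : 0 < j.val := by omega
  have key : Tu P j hj0 * Tu P i hi * Tu P j hj0 = Tu P i hi * Tu P j hj0 * Tu P i hi :=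
    Units.ext (T_braid P i j hi hj)
  have h2 : Tu P j hj0 * (Tu P i hi)⁻¹ * (Tu P j hj0)⁻¹ =
      (Tu P i hi)⁻¹ * (Tu P j hj0)⁻¹ * Tu P i hi := by
    rw [mul_inv_eq_iff_eq_mul, mul_inv_eq_iff_eq_mul, mul_assoc, mul_assoc, ← mul_assoc (Tu P i hi),
      ← key]
    group
  rw [Tinv_eq_unit P i hi, Tinv_eq_unit P j hj0]
  exact congrArg Units.val h2

lemma T_C_near (j : Fin n) (d a : ℕ) (ha : 0 < a) (h : j.val = a + 1 + d) :
    Commute (T P j) (C P n a) := by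
  have hjn := j.isLt
  induction d generalizing a with
  | zero =>
    obtain ⟨b, hb⟩ : ∃ b : Fin n, b = ⟨a, by omega⟩ := ⟨_, rfl⟩
    have hbv : b.val = a := by rw [hb]
    have hj' : j = ⟨a + 1, by omega⟩ := Fin.ext (by simpa using h)
    have hbj : j.val = b.val + 1 := by omega
    have hb0 : 0 < b.val := by omega
    rw [C_step P a (by omega), C_step P (a + 1) (by omega), ← hb, ← hj']
    have h1 := TTT_inv P b j hb0 hbj
    have h2 := TSS P b j hb0 hbj
    have h3 := (T_C_far P b hb0 (a + 1 + 1) (by omega)).eq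
    rw [commute_iff_eq]
    simp only [mul_assoc] at h1 h2 h3 ⊢
    rw [← h2, ← mul_assoc (C P n (a + 1 + 1)) (T P b), ← h3]
    calc T P j * (Tinv P b * (Tinv P j * (C P n (a + 1 + 1) * (S P j * S P b))))
        = (T P j * (Tinv P b * Tinv P j)) * (C P n (a + 1 + 1) * (S P j * S P b)) := by
          simp only [mul_assoc]
      _ = _ := by rw [h1]; simp only [mul_assoc]
  | succ d ih =>
    rw [C_step P a (by omega)]
    have h1 : Commute (T P j) (T P ⟨a, by omega⟩) :=
      (TT_comm P ⟨a, by omega⟩ j ha (by simp; omega)).symm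
    exact ((comm_Tinv P ⟨a, by omega⟩ ha h1).mul_right (ih (a + 1) (by omega) (by omega))).mul_right
      (TS_comm' P ⟨a, by omega⟩ j ha (by simp; omega))

lemma varpi_vec [NeZero n] (s : Word n) :
    varpi P (vec P s) = (if s 0 = 0 then P.lam₁ else P.lam₂) • vec P s := by
  unfold varpi
  rw [ofWords_vec]

lemma T_varpi [NeZero n] (j : Fin n) (hj : 2 ≤ j.val) : Commute (T P j) (varpi P) := by
  have h1 : (0 : Fin n) ≠ j := fun e => by have := congrArg Fin.val e; simp at this; omega
  have h2 : (0 : Fin n) ≠ prev j := fun e => by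
    have := congrArg Fin.val e; simp [prev] at this; omega
  rw [commute_iff_eq, T_eq]
  apply ext_vec P
  intro s
  simp only [Module.End.mul_apply, loc_vec P, map_add, map_smul, varpi_vec,
    swapW_of_ne j s 0 h2 h1]
  module

lemma T_X [NeZero n] (j : Fin n) (hj : 2 ≤ j.val) : Commute (T P j) (X P) := by
  rw [X_eq]
  exact (T_C_near P j (j.val - 2) 1 one_pos (by omega)).mul_right (T_varpi P j hj)

/-- The span of the words with letter `v₂` at the position `p` which agree with `s` before `p`. -/
def Y (s : Word n) (p : Fin n) : Submodule k (TensorSpace P n) :=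
  Submodule.span k {v | ∃ t : Word n, v = vec P t ∧ t p = 1 ∧ ∀ j < p, t j = s j}

lemma Fin2_cases (x : Fin 2) : x = 0 ∨ x = 1 := by omega

lemma Tinv_mem_Y (s : Word n) (p b : Fin n) (hb : b.val = p.val + 1) (t : Word n) (h1 : t b = 1)
    (h2 : ∀ j < p, t j = s j) : Tinv P b (vec P t) ∈ Y P s p := by
  have hp : prev b = p := Fin.ext (by simp [prev, hb])
  have hb0 : 0 < b.val := by omega
  rcases Fin2_cases (t p) with h | h
  · rw [Tinv_zero_one P b hb0 t (by rw [hp, h]) h1]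
    refine Submodule.subset_span ⟨_, rfl, ?_, ?_⟩
    · rw [← hp, swapW_left, h1]
    · intro j hj
      rw [swapW_of_ne, h2 j hj]
      · rw [hp]; exact hj.ne
      · intro e
        have h3 := Fin.lt_def.mp hj
        rw [e] at h3
        omega
  · rw [Tinv_same P b hb0 t (by rw [hp, h, h1])]
    exact Submodule.smul_mem _ _ (Submodule.subset_span ⟨t, rfl, h, h2⟩)

lemma map_mem_of_span {f : Module.End k (TensorSpace P n)} {s s' : Word n} {p p' : Fin n}
    (h : ∀ t : Word n, t p = 1 → (∀ j < p, t j = s j) → f (vec P t) ∈ Y P s' p')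
    {v : TensorSpace P n} (hv : v ∈ Y P s p) : f v ∈ Y P s' p' := by
  have : Y P s p ≤ (Y P s' p').comap f := by
    refine Submodule.span_le.mpr ?_
    rintro _ ⟨t, rfl, h1, h2⟩
    exact h t h1 h2
  exact this hv

lemma basic (d : ℕ) : ∀ (p : Fin n), n = p.val + 1 + d → ∀ s : Word n,
    (s p = 1 → C P n (p.val + 1) (vec P s) = vec P s) ∧
    (s p = 0 → C P n (p.val + 1) (vec P s) - vec P s ∈ Y P s p) := by
  have h0 := P.q_ne_zero
  induction d with
  | zero =>
    intro p hp s
    rw [C_end P _ (by omega)]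
    exact ⟨fun _ => rfl, fun _ => by simp⟩
  | succ d ih =>
    intro p hp s
    obtain ⟨b, hb⟩ : ∃ b : Fin n, b = ⟨p.val + 1, by omega⟩ := ⟨_, rfl⟩
    have hbv : b.val = p.val + 1 := by rw [hb]
    have hb0 : 0 < b.val := by omega
    have hpb : prev b = p := Fin.ext (by simp [prev, hbv])
    have hlt : p < b := by rw [Fin.lt_def]; omega
    rw [C_step P _ (by omega : p.val + 1 < n), ← hb]
    have ihb := ih b (by omega)
    rw [hbv] at ihb
    simp only [Module.End.mul_apply]
    rcases Fin2_cases (s b) with hsb | hsb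
    · refine ⟨fun hsp => ?_, fun hsp => ?_⟩
      · rw [S_ne P b s (by rw [hpb, hsp, hsb]; decide),
          (ihb (swapW b s)).1 (by rw [swapW_right, hpb, hsp]),
          Tinv_zero_one P b hb0 _ (by rw [swapW_left, hsb]) (by rw [swapW_right, hpb, hsp]),
          swapW_swapW]
      · have hy := (ihb s).2 hsb
        rw [S_same P b s (by rw [hpb, hsp, hsb])]
        have e : Tinv P b (C P n (p.val + 1 + 1) (P.q • vec P s)) - vec P s =
            P.q • Tinv P b (C P n (p.val + 1 + 1) (vec P s) - vec P s) := by
          rw [map_sub, Tinv_same P b hb0 s (by rw [hpb, hsp, hsb]), map_smul, map_smul, smul_sub,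
            smul_smul, mul_inv_cancel₀ h0, one_smul]
        rw [e]
        refine Submodule.smul_mem _ _ (map_mem_of_span P ?_ hy)
        intro t h1 h2
        exact Tinv_mem_Y P s p b hbv t h1 fun j hj => h2 j (hj.trans hlt)
    · refine ⟨fun hsp => ?_, fun hsp => ?_⟩
      · rw [S_same P b s (by rw [hpb, hsp, hsb]), map_smul, (ihb s).1 hsb, map_smul,
          Tinv_same P b hb0 s (by rw [hpb, hsp, hsb]), smul_smul, mul_inv_cancel₀ h0, one_smul]
      · rw [S_ne P b s (by rw [hpb, hsp, hsb]; decide)]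
        have hagree : ∀ j < p, swapW b s j = s j := by
          intro j hj
          rw [swapW_of_ne]
          · rw [hpb]; exact hj.ne
          · exact (hj.trans hlt).ne
        have hy := (ihb (swapW b s)).2 (by rw [swapW_right, hpb, hsp])
        have e : Tinv P b (C P n (p.val + 1 + 1) (vec P (swapW b s))) - vec P s =
            Tinv P b (C P n (p.val + 1 + 1) (vec P (swapW b s)) - vec P (swapW b s)) -
              (P.q - P.q⁻¹) • vec P (swapW b s) := by
          rw [map_sub, Tinv_one_zero P b hb0 (swapW b s) (by rw [swapW_left, hsb])
            (by rw [swapW_right, hpb, hsp]), swapW_swapW]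
          module
        rw [e]
        refine Submodule.sub_mem _ (map_mem_of_span P ?_ hy) (Submodule.smul_mem _ _ ?_)
        · intro t h1 h2
          exact Tinv_mem_Y P s p b hbv t h1
            fun j hj => (h2 j (hj.trans hlt)).trans (hagree j hj)
        · refine Submodule.subset_span ⟨_, rfl, ?_, hagree⟩
          rw [← hpb, swapW_left, hsb]

lemma X_one [NeZero n] (s : Word n) (h : s 0 = 1) : X P (vec P s) = P.lam₂ • vec P s := by
  have hn : 0 < n := Nat.pos_of_ne_zero (NeZero.ne n)
  have hb := (basic P (n - 1) (0 : Fin n) (by simp; omega) s).1 h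
  simp only [Fin.val_zero, zero_add] at hb
  rw [X_eq, Module.End.mul_apply, varpi_vec, if_neg (by simp [h]), map_smul, hb]

lemma X_zero [NeZero n] (s : Word n) (h : s 0 = 0) :
    X P (vec P s) - P.lam₁ • vec P s ∈ Y P s 0 := by
  have hn : 0 < n := Nat.pos_of_ne_zero (NeZero.ne n)
  have hb := (basic P (n - 1) (0 : Fin n) (by simp; omega) s).2 h
  simp only [Fin.val_zero, zero_add] at hb
  rw [X_eq, Module.End.mul_apply, varpi_vec, if_pos h, map_smul, ← smul_sub]
  exact Submodule.smul_mem _ _ hb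

lemma X_Y [NeZero n] (s : Word n) {v : TensorSpace P n} (hv : v ∈ Y P s 0) :
    X P v = P.lam₂ • v := by
  have : Y P s 0 ≤ LinearMap.ker (X P - P.lam₂ • (1 : Module.End k (TensorSpace P n))) := by
    refine Submodule.span_le.mpr ?_
    rintro _ ⟨t, rfl, h1, -⟩
    simp [X_one P t h1]
  have h := this hv
  rw [LinearMap.mem_ker, LinearMap.sub_apply, LinearMap.smul_apply, Module.End.one_apply] at h
  exact sub_eq_zero.mp h

/-- The operator `X - λ₁`. -/
def E₀ [NeZero n] : Module.End k (TensorSpace P n) := X P - P.lam₁ • 1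

lemma E₀_apply [NeZero n] (v : TensorSpace P n) : E₀ P v = X P v - P.lam₁ • v := by
  simp [E₀]

lemma E₀_sq [NeZero n] : E₀ P (n := n) * E₀ P = -gaussInt P.q P.m • E₀ P := by
  apply ext_vec P
  intro s
  rw [← P.lam_sub, Module.End.mul_apply, LinearMap.smul_apply]
  rcases Fin2_cases (s 0) with h | h
  · have hy := X_zero P s h
    rw [← E₀_apply] at hy
    rw [E₀_apply P (E₀ P (vec P s)), X_Y P s hy, sub_smul]
  · have h1 : E₀ P (vec P s) = (P.lam₂ - P.lam₁) • vec P s := by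
      rw [E₀_apply, X_one P s h, sub_smul]
    rw [h1, map_smul, h1]

lemma E_same (i : Fin n) (s : Word n) (h : s (prev i) = s i) : E P i (vec P s) = 0 := by
  rw [E, LinearMap.sub_apply, T_same P i s h, LinearMap.smul_apply, Module.End.one_apply, sub_self]

lemma E_E₀_E [NeZero n] (i : Fin n) (hi : i.val = 1) :
    E P i * E₀ P * E P i = gaussInt P.q (P.m - 1) • E P i := by
  have h0 := P.q_ne_zero
  have hi0 : 0 < i.val := by omega
  have hin := i.isLt
  have hp : prev i = 0 := Fin.ext (by simp [prev, hi])
  have hi' : i = ⟨1, by omega⟩ := Fin.ext hi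
  -- the key computation
  have key : ∀ s : Word n, s 0 = 0 → s i = 1 →
      E P i (E₀ P (vec P (swapW i s) - P.q⁻¹ • vec P s)) =
        gaussInt P.q (P.m - 1) • (vec P (swapW i s) - P.q⁻¹ • vec P s) := by
    intro s h1 h2
    have hs'0 : swapW i s 0 = 1 := by rw [← hp, swapW_left, h2]
    have hs'i : swapW i s i = 0 := by rw [swapW_right, hp, h1]
    have hb := (basic P (n - 2) i (by omega) (swapW i s)).2 hs'i
    set y := C P n (i.val + 1) (vec P (swapW i s)) - vec P (swapW i s) with hydef
    have hy0 : y ∈ LinearMap.ker (E P i) ⊓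
        LinearMap.ker (Tinv P i - P.q⁻¹ • (1 : Module.End k (TensorSpace P n))) := by
      have hle : Y P (swapW i s) i ≤ LinearMap.ker (E P i) ⊓
          LinearMap.ker (Tinv P i - P.q⁻¹ • (1 : Module.End k (TensorSpace P n))) := by
        refine Submodule.span_le.mpr ?_
        rintro _ ⟨t, rfl, ht1, ht2⟩
        have ht0 : t (prev i) = t i := by
          rw [hp, ht1, ht2 0 (by rw [Fin.lt_def, Fin.val_zero]; omega), hs'0]
        refine ⟨E_same P i t ht0, ?_⟩
        simp [Tinv_same P i hi0 t ht0]
      exact hle hb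
    have hyE : E P i y = 0 := hy0.1
    have hyT : Tinv P i y = P.q⁻¹ • y := by
      have h := hy0.2
      simp only [SetLike.mem_coe, LinearMap.mem_ker, LinearMap.sub_apply, LinearMap.smul_apply,
        Module.End.one_apply] at h
      exact sub_eq_zero.mp h
    have hC : C P n (i.val + 1) (vec P (swapW i s)) = vec P (swapW i s) + y := by
      rw [hydef]; abel
    have hXs : X P (vec P s) =
        P.lam₁ • (vec P s - (P.q - P.q⁻¹) • vec P (swapW i s) + P.q⁻¹ • y) := by
      rw [X_eq, Module.End.mul_apply, varpi_vec, if_pos h1, map_smul, C_step P 1 (by omega), ← hi']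
      simp only [Module.End.mul_apply]
      rw [S_ne P i s (by rw [hp, h1, h2]; decide)]
      have : (1 + 1 : ℕ) = i.val + 1 := by omega
      rw [this, hC, map_add, hyT, Tinv_one_zero P i hi0 _ (by rw [hp, hs'0]) hs'i, swapW_swapW]
    have hEs' : E P i (vec P (swapW i s)) = -P.q • (vec P (swapW i s) - P.q⁻¹ • vec P s) := by
      rw [E, LinearMap.sub_apply, T_one_zero P i _ (by rw [hp, hs'0]) hs'i, LinearMap.smul_apply,
        Module.End.one_apply, swapW_swapW]
      match_scalars <;> field_simp
    have hE₀ : E₀ P (vec P (swapW i s) - P.q⁻¹ • vec P s) =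
        (P.lam₂ - P.lam₁ * P.q⁻¹ * P.q⁻¹) • vec P (swapW i s) -
          (P.lam₁ * P.q⁻¹ * P.q⁻¹) • y := by
      rw [map_sub, map_smul, E₀_apply, E₀_apply, X_one P _ hs'0, hXs]
      match_scalars <;> field_simp <;> ring
    rw [hE₀, map_sub, map_smul, map_smul, hyE, hEs', smul_zero, sub_zero, smul_smul, ← P.lam_comb]
    congr 1
    field_simp
    ring
  apply ext_vec P
  intro s
  simp only [Module.End.mul_apply, LinearMap.smul_apply]
  rcases Fin2_cases (s 0) with h1 | h1 <;> rcases Fin2_cases (s i) with h2 | h2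
  · rw [E_same P i s (by rw [hp, h1, h2])]
    simp
  · have : E P i (vec P s) = vec P (swapW i s) - P.q⁻¹ • vec P s := by
      rw [E, LinearMap.sub_apply, T_zero_one P i _ (by rw [hp, h1]) h2, LinearMap.smul_apply,
        Module.End.one_apply]
      module
    rw [this, key s h1 h2]
  · have h1' : swapW i s 0 = 0 := by rw [← hp, swapW_left, h2]
    have h2' : swapW i s i = 1 := by rw [swapW_right, hp, h1]
    have h := key (swapW i s) h1' h2'
    rw [swapW_swapW] at h
    have : E P i (vec P s) = -P.q • (vec P s - P.q⁻¹ • vec P (swapW i s)) := by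
      rw [E, LinearMap.sub_apply, T_one_zero P i _ (by rw [hp, h1]) h2, LinearMap.smul_apply,
        Module.End.one_apply]
      match_scalars <;> field_simp
    rw [this, map_smul, map_smul, h, smul_comm]
  · rw [E_same P i s (by rw [hp, h1, h2])]
    simp

/-! ## The blob algebra action -/

/-- The operator by which `U_i` acts on the tensor space: `T_1 - λ₁` for `i = 0` (where `T_1` is
the action of `X`), and `T_{i+1} - q` for `i ≥ 1`. -/
def opU [NeZero n] (i : Fin n) : Module.End k (TensorSpace P n) :=
  if i = 0 then X P - P.lam₁ • 1 else T P i - P.q • 1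

lemma opU_zero [NeZero n] (i : Fin n) (hi : i.val = 0) : opU P i = E₀ P := by
  have : i = 0 := Fin.ext (by simpa using hi)
  rw [opU, if_pos this, E₀]

lemma opU_pos [NeZero n] (i : Fin n) (hi : 0 < i.val) : opU P i = E P i := by
  have : i ≠ 0 := fun e => by subst e; simp at hi
  rw [opU, if_neg this, E]

lemma opU_rel [NeZero n] ⦃x y : FreeAlgebra k (Fin n)⦄ (h : BlobRel P n x y) :
    FreeAlgebra.lift k (opU P) x = FreeAlgebra.lift k (opU P) y := by
  cases h with
  | sq i hi =>
    simp only [map_mul, map_smul, FreeAlgebra.lift_ι_apply, opU_pos P i hi]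
    exact E_sq P i hi
  | sq_zero i hi =>
    simp only [map_mul, map_smul, FreeAlgebra.lift_ι_apply, opU_zero P i hi]
    exact E₀_sq P
  | one_zero_one i j hi hj =>
    simp only [map_mul, map_smul, FreeAlgebra.lift_ι_apply, opU_zero P j hj,
      opU_pos P i (by omega)]
    exact E_E₀_E P i hi
  | adjacent i j hi hj h =>
    simp only [map_mul, FreeAlgebra.lift_ι_apply, opU_pos P i hi, opU_pos P j hj]
    rcases h with h | h
    · exact E_left P i j hi h.symm
    · exact E_right P j i hj h.symm
  | far i j h =>
    simp only [map_mul, FreeAlgebra.lift_ι_apply, opU_pos P j (by omega)]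
    rcases Nat.eq_zero_or_pos i.val with hi | hi
    · rw [opU_zero P i hi]
      have h1 : Commute (X P) (T P j) := (T_X P j (by omega)).symm
      exact (h1.sub_left ((Commute.one_left _).smul_left _)).sub_right
        ((Commute.one_right _).smul_right _)
    · rw [opU_pos P i hi]
      have h1 : Commute (T P i) (T P j) := TT_comm P i j hi h
      exact (h1.sub_left ((Commute.one_left _).smul_left _)).sub_right
        ((Commute.one_right _).smul_right _)

/-- The representation of the blob algebra on the tensor space. -/
def rep (n : ℕ) [NeZero n] : Blob P n →ₐ[k] Module.End k (TensorSpace P n) :=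
  Blob.lift P (FreeAlgebra.lift k (opU P)) (opU_rel P)

lemma rep_U [NeZero n] (i : Fin n) : rep P n (Blob.U P i) = opU P i := by
  rw [rep, Blob.U, Blob.lift_mk, FreeAlgebra.lift_ι_apply]

/-- The tensor space as a module for the blob algebra. -/
instance [NeZero n] : Module (Blob P n) (TensorSpace P n) :=
  Module.compHom (TensorSpace P n) (rep P n).toRingHom

lemma smul_def [NeZero n] (b : Blob P n) (v : TensorSpace P n) : b • v = rep P n b v := rfl

instance [NeZero n] : IsScalarTower k (Blob P n) (TensorSpace P n) where
  smul_assoc c b v := by simp [smul_def]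

/-- The weight of a word: the number of letters `v₁` minus the number of letters `v₂`. -/
def weight (s : Word n) : ℤ :=
  ((Finset.univ.filter fun j => s j = 0).card : ℤ) - (Finset.univ.filter fun j => s j = 1).card

lemma weight_swapW (i : Fin n) (s : Word n) : weight (swapW i s) = weight s := by
  have h : ∀ x : Fin 2, (Finset.univ.filter fun j => swapW i s j = x).card =
      (Finset.univ.filter fun j => s j = x).card := by
    intro x
    simp only [Finset.card_filter]
    exact Equiv.sum_comp (Equiv.swap (prev i) i) fun j => if s j = x then 1 else 0
  unfold weight
  rw [h, h]

/-- The span of the words of weight `lam`. -/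
def W (n : ℕ) (lam : ℤ) : Submodule k (TensorSpace P n) :=
  Submodule.span k (vec P '' {s : Word n | weight s = lam})

/-- The operators which preserve the span of the words of weight `lam`. -/
def stab (n : ℕ) (lam : ℤ) : Subalgebra k (Module.End k (TensorSpace P n)) where
  carrier := {f | W P n lam ≤ (W P n lam).comap f}
  mul_mem' hf hg _ hv := hf (hg hv)
  add_mem' hf hg _ hv := (W P n lam).add_mem (hf hv) (hg hv)
  algebraMap_mem' c _ hv := (W P n lam).smul_mem c hv

lemma mem_stab {lam : ℤ} {f : Module.End k (TensorSpace P n)}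
    (h : ∀ s : Word n, weight s = lam → f (vec P s) ∈ W P n lam) : f ∈ stab P n lam := by
  have : W P n lam ≤ (W P n lam).comap f := by
    refine Submodule.span_le.mpr ?_
    rintro _ ⟨s, hs, rfl⟩
    exact h s hs
  exact this

lemma vec_mem_W {lam : ℤ} {s : Word n} (h : weight s = lam) : vec P s ∈ W P n lam :=
  Submodule.subset_span ⟨s, h, rfl⟩

lemma loc_mem_stab (lam : ℤ) (α β : Fin 2 → Fin 2 → k) (i : Fin n) :
    loc P α β i ∈ stab P n lam := by
  refine mem_stab P fun s hs => ?_
  rw [loc_vec P]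
  exact Submodule.add_mem _ (Submodule.smul_mem _ _ (vec_mem_W P hs))
    (Submodule.smul_mem _ _ (vec_mem_W P ((weight_swapW i s).trans hs)))

lemma T_mem_stab (lam : ℤ) (i : Fin n) : T P i ∈ stab P n lam := by
  rw [T_eq]
  exact loc_mem_stab P lam _ _ i

lemma sand_mem_stab (lam : ℤ) (l : List (Fin n)) (hl : ∀ a ∈ l, 0 < a.val) :
    sand P l ∈ stab P n lam := by
  induction l with
  | nil => rw [sand_nil]; exact one_mem _
  | cons a l ih =>
    rw [sand_cons, Tinv_eq P a (hl a (by simp)), S_eq]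
    exact mul_mem (mul_mem (sub_mem (T_mem_stab P lam a) (Subalgebra.smul_mem _ (one_mem _) _))
      (ih fun b hb => hl b (by simp [hb]))) (loc_mem_stab P lam _ _ a)

lemma opU_mem_stab [NeZero n] (lam : ℤ) (i : Fin n) : opU P i ∈ stab P n lam := by
  unfold opU
  split_ifs
  · refine sub_mem ?_ (Subalgebra.smul_mem _ (one_mem _) _)
    rw [X_eq]
    refine mul_mem (sand_mem_stab P lam _ fun a ha => le_of_mem_drop 1 a ha) ?_
    refine mem_stab P fun s hs => ?_
    rw [varpi_vec]
    exact Submodule.smul_mem _ _ (vec_mem_W P hs)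
  · exact sub_mem (T_mem_stab P lam i) (Subalgebra.smul_mem _ (one_mem _) _)

lemma rep_mem_stab [NeZero n] (lam : ℤ) (b : Blob P n) : rep P n b ∈ stab P n lam := by
  obtain ⟨x, rfl⟩ := Blob.mk_surjective P n b
  have h (x) : rep P n (Blob.mk P n x) = FreeAlgebra.lift k (opU P) x := Blob.lift_mk P _ _ x
  rw [h]
  induction x using FreeAlgebra.induction with
  | grade0 c => rw [AlgHom.commutes]; exact Subalgebra.algebraMap_mem _ c
  | grade1 i => rw [FreeAlgebra.lift_ι_apply]; exact opU_mem_stab P lam i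
  | mul x y hx hy => rw [map_mul]; exact mul_mem hx hy
  | add x y hx hy => rw [map_add]; exact add_mem hx hy

/-- The permutation module `M_n(λ)`: the `b_n`-submodule of `V^{⊗ n}` with basis the words in which
the number of `v₁` minus the number of `v₂` is `lam`. -/
def M (n : ℕ) [NeZero n] (lam : ℤ) : Submodule (Blob P n) (TensorSpace P n) where
  carrier := W P n lam
  add_mem' := Submodule.add_mem _
  zero_mem' := Submodule.zero_mem _
  smul_mem' b _ hv := (show W P n lam ≤ (W P n lam).comap (rep P n b) from
    rep_mem_stab P lam b) hv

end ATY

/-! ## Localization and globalization -/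

section Idempotent

variable {B : Type*} [Ring B] {e : B} (he : IsIdempotentElem e)

lemma corner_left (a : he.Corner) : e * a.1 = a.1 :=
  ((Subsemigroup.mem_corner_iff he).mp a.2).1

lemma corner_right (a : he.Corner) : a.1 * e = a.1 :=
  ((Subsemigroup.mem_corner_iff he).mp a.2).2

/-- The localization `F M = e M`, as an additive group. -/
def LocF (_he : IsIdempotentElem e) (M : Type*) [AddCommGroup M] [Module B M] : AddSubgroup M :=
  (DistribSMul.toAddMonoidHom M e).range

lemma LocF.smul_eq {M : Type*} [AddCommGroup M] [Module B M] (y : LocF he M) :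
    e • (y : M) = y := by
  obtain ⟨_, x, rfl⟩ := y
  simp [smul_smul, he.eq]

/-- `F M = e M` is a module for `e B e`. -/
instance (M : Type*) [AddCommGroup M] [Module B M] : Module he.Corner (LocF he M) where
  smul a y := ⟨a.1 • (y : M), a.1 • (y : M), by
    simp only [DistribSMul.toAddMonoidHom_apply, smul_smul, corner_left he a]⟩
  one_smul y := Subtype.ext (LocF.smul_eq he y)
  mul_smul a b y := Subtype.ext (mul_smul a.1 b.1 (y : M))
  smul_zero a := Subtype.ext (smul_zero a.1)
  smul_add a y z := Subtype.ext (smul_add a.1 (y : M) (z : M))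
  add_smul a b y := Subtype.ext (add_smul a.1 b.1 (y : M))
  zero_smul y := Subtype.ext (zero_smul B (y : M))

lemma LocF.coe_smul {M : Type*} [AddCommGroup M] [Module B M] (a : he.Corner) (y : LocF he M) :
    ((a • y : LocF he M) : M) = a.1 • (y : M) := rfl

/-- The right action of `e B e` on the left ideal `B e`. -/
def mulCorner (x : Ideal.span {e}) (a : he.Corner) : Ideal.span {e} :=
  ⟨(x : B) * a.1, Ideal.mem_span_singleton'.mpr
    ⟨(x : B) * a.1, by rw [mul_assoc, corner_right he a]⟩⟩

/-- The relations `x a ⊗ y = x ⊗ a y` of the tensor product over `e B e`. -/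
def balanced (N : Type*) [AddCommGroup N] [Module he.Corner N] :
    Submodule B (Ideal.span {e} ⊗[ℤ] N) :=
  Submodule.span B {z | ∃ (x : Ideal.span {e}) (a : he.Corner) (y : N),
    z = mulCorner he x a ⊗ₜ[ℤ] y - x ⊗ₜ[ℤ] (a • y)}

/-- The globalization `G N = B e ⊗_{e B e} N`, as a left `B`-module. -/
abbrev GlobG (N : Type*) [AddCommGroup N] [Module he.Corner N] : Type _ :=
  (Ideal.span {e} ⊗[ℤ] N) ⧸ balanced he N

/-- The multiplication map `B e ⊗_ℤ e M → M`. -/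
def mulMap (M : Type*) [AddCommGroup M] [Module B M] :
    Ideal.span {e} ⊗[ℤ] LocF he M →ₗ[B] M :=
  TensorProduct.AlgebraTensorModule.lift
    { toFun := fun x =>
        { toFun := fun y => (x : B) • (y : M)
          map_add' := fun y z => smul_add (x : B) (y : M) (z : M)
          map_smul' := fun c y => smul_comm (x : B) c (y : M) }
      map_add' := fun x y => LinearMap.ext fun z => add_smul (x : B) (y : B) (z : M)
      map_smul' := fun b x => LinearMap.ext fun z => mul_smul b (x : B) (z : M) }

lemma mulMap_tmul (M : Type*) [AddCommGroup M] [Module B M] (x : Ideal.span {e})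
    (y : LocF he M) : mulMap he M (x ⊗ₜ[ℤ] y) = (x : B) • (y : M) := rfl

/-- The adjointness map `G (F M) → M`, `x ⊗ y ↦ x y`, the counit of the adjoint pair `(G, F)`. -/
def adjMap (M : Type*) [AddCommGroup M] [Module B M] : GlobG he (LocF he M) →ₗ[B] M :=
  (balanced he (LocF he M)).liftQ (mulMap he M) <| Submodule.span_le.mpr <| by
    rintro _ ⟨x, a, y, rfl⟩
    simp [mulMap_tmul, mulCorner, LocF.coe_smul, mul_smul]

lemma adjMap_mk (M : Type*) [AddCommGroup M] [Module B M] (x : Ideal.span {e})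
    (y : LocF he M) :
    adjMap he M (Submodule.Quotient.mk (x ⊗ₜ[ℤ] y)) = (x : B) • (y : M) := rfl

end Idempotent

/-- The element `e = -[2]⁻¹ U_{n-1}` of the blob algebra. -/
def Blob.e {k : Type*} [Field k] (P : BlobParams k) (n : ℕ) [NeZero n] : Blob P n :=
  -(gaussInt P.q 2)⁻¹ • Blob.U P ⟨n - 1, Nat.sub_one_lt (NeZero.ne n)⟩

lemma Blob.e_idem {k : Type*} [Field k] (P : BlobParams k) (n : ℕ) [NeZero n] (hn : 2 ≤ n) :
    IsIdempotentElem (Blob.e P n) := by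
  have h : Blob.U P ⟨n - 1, Nat.sub_one_lt (NeZero.ne n)⟩ *
      Blob.U P ⟨n - 1, Nat.sub_one_lt (NeZero.ne n)⟩ =
      -gaussInt P.q 2 • Blob.U P ⟨n - 1, Nat.sub_one_lt (NeZero.ne n)⟩ := by
    have := Blob.mk_rel P (BlobRel.sq (P := P) (n := n)
      ⟨n - 1, Nat.sub_one_lt (NeZero.ne n)⟩ (by simp; omega))
    rw [map_mul, map_smul] at this
    exact this
  have h2 := P.gaussInt_two_ne_zero
  unfold IsIdempotentElem Blob.e
  rw [smul_mul_smul_comm, h, smul_smul]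
  congr 1
  field_simp

/-! ## Standard modules -/

/-- The product `U_{n-1} U_{n-3} ⋯ U_{n-2j+1}` (with `j` factors; only used for `2 j ≤ n`). -/
def Blob.cups {k : Type*} [Field k] (P : BlobParams k) (n : ℕ) : ℕ → Blob P n
  | 0 => 1
  | j + 1 => Blob.cups P n j *
      if h : n - 1 - 2 * j < n then Blob.U P ⟨n - 1 - 2 * j, h⟩ else 0

/-- The scalar by which `U_0` acts on the bottom layer of `Δ_n(λ)`, `λ ≠ 0`: it is `0` (so that
`X` acts by `λ₁`) for `λ > 0`, and `-[m]` (so that `X` acts by `λ₂`) for `λ < 0`. -/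
def blobScalar {k : Type*} [Field k] (P : BlobParams k) (lam : ℤ) : k :=
  if 0 < lam then 0 else -gaussInt P.q P.m

/-- The relations of the standard module: `U_i u = 0` for `0 < i < |λ|`, and `U_0 u = c u` with
`c = 0` or `c = -[m]` according to the sign of `λ ≠ 0`, where
`u = U_{n-1} U_{n-3} ⋯ U_{|λ|+1}`. -/
def standardRel {k : Type*} [Field k] (P : BlobParams k) (n : ℕ) [NeZero n] (lam : ℤ) :
    Submodule (Blob P n) (Ideal.span {Blob.cups P n ((n - lam.natAbs) / 2)}) :=
  Submodule.span (Blob P n) {x |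
    (∃ i : Fin n, 0 < i.val ∧ i.val < lam.natAbs ∧
      (x : Blob P n) = Blob.U P i * Blob.cups P n ((n - lam.natAbs) / 2)) ∨
    (lam ≠ 0 ∧ (x : Blob P n) = Blob.U P 0 * Blob.cups P n ((n - lam.natAbs) / 2) -
      blobScalar P lam • Blob.cups P n ((n - lam.natAbs) / 2))}

/-- The standard module `Δ_n(λ)`, `λ ∈ {n, n - 2, …, -n}`: the left ideal `b_n u`, where
`u = U_{n-1} U_{n-3} ⋯ U_{|λ|+1}`, modulo `standardRel`. It is the globalization, from `b_{|λ|}`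
to `b_n`, of the one-dimensional module `Δ_{|λ|}(λ)` of `b_{|λ|}`, on which `U_1, …, U_{|λ|-1}` act
by zero and `U_0` acts by `0` or `-[m]`; it has a basis of half diagrams with `|λ|` through-lines. -/
abbrev StandardModule {k : Type*} [Field k] (P : BlobParams k) (n : ℕ) [NeZero n] (lam : ℤ) :
    Type _ :=
  Ideal.span {Blob.cups P n ((n - lam.natAbs) / 2)} ⧸ standardRel P n lam

/-! ## The objects of the theorem -/

/-- `G (F M_n(λ))`, for `n ≥ 2`. -/
abbrev GFM {k : Type*} [Field k] (P : BlobParams k) (n : ℕ) [NeZero n] (hn : 2 ≤ n) (lam : ℤ) :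
    Type _ :=
  GlobG (Blob.e_idem P n hn) (LocF (Blob.e_idem P n hn) (ATY.M P n lam))

/-- The adjointness map `φ_λ : G (F M_n(λ)) → M_n(λ)`, for `n ≥ 2`. -/
def phi {k : Type*} [Field k] (P : BlobParams k) (n : ℕ) [NeZero n] (hn : 2 ≤ n) (lam : ℤ) :
    GFM P n hn lam →ₗ[Blob P n] ATY.M P n lam :=
  adjMap (Blob.e_idem P n hn) (ATY.M P n lam)

end

/-! ## Relations between the generators and generation by the idempotent -/

namespace Blob

variable {k : Type*} [Field k] (P : BlobParams k) {n : ℕ}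

/-! Write M = M_n(λ) and B = λ₂ − λ₁ = −[m]; the condition λ ≠ ±n says that n₁, n₂ > 0. Up to a
scalar, the functional p (`permFun`), sending a word to q to the power of its `rank`, is the only
one on M that vanishes on U_i M for all i ≥ 1. Hence the sum of these U_i M is the hyperplane ker p.
Let p₁ (`permFun₁`) be the part of p carried by the words beginning with v₁. Everything rests on the
formula p ∘ U_0 = κ p₁ + B p with κ = λ₁ q^(−2n₂) − λ₂ (`permFun_U_zero`, `obstruction`). For q a
primitive l-th root of unity with l odd, κ = 0 exactly when n₂ ≡ m mod l.

Image. The image of φ_λ is the submodule generated by eM. Since U_i = U_i U_{i+1} U_i, it contains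
every U_i M with i ≥ 1, hence ker p. So φ_λ is surjective unless U_0 preserves ker p, and by the
formula this happens only for κ = 0. Being generated by its image under e (`GeneratedByE`) is
invariant under isomorphism; G F M and Δ_n(λ) have this property, and M lacks it when κ = 0. This
excludes both isomorphisms.

Kernel. The kernel of φ_λ is killed by e, hence by all U_i with i ≥ 1, so injectivity is a question
about extensions of M by one-dimensional modules on which U_0 acts by c = 0 or c = B. An extension
is described by cocycles. Those along the U_i with i ≥ 1 are always coboundaries
(`exists_primitive`, through the combinatorial `exists_potential`). What remains is a combination of
p₁ and p, which for κ ≠ 0 is a multiple of p ∘ U_0 − c p, again a coboundary (`exists_coboundary`).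
So for κ ≠ 0 a nonzero kernel would yield a nonzero functional on G F M whose kernel is a submodule
containing e G F M, which is impossible (`injective_of_surjective`). For κ = 0 and c = B the
coboundary p ∘ U_0 − B p = κ p₁ vanishes, and p₁ itself defines an extension of M onto which enough
of G F M maps to exhibit a nonzero element of the kernel (`phi_not_injective`). -/

lemma U_sq (i : Fin n) (hi : 0 < i.val) : U P i * U P i = -gaussInt P.q 2 • U P i := by
  have := mk_rel P (BlobRel.sq (P := P) i hi)
  rwa [map_mul, map_smul] at this

lemma U_sq_zero (i : Fin n) (hi : i.val = 0) : U P i * U P i = -gaussInt P.q P.m • U P i := by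
  have := mk_rel P (BlobRel.sq_zero (P := P) i hi)
  rwa [map_mul, map_smul] at this

lemma U_adjacent (i j : Fin n) (hi : 0 < i.val) (hj : 0 < j.val)
    (h : i.val + 1 = j.val ∨ j.val + 1 = i.val) : U P i * U P j * U P i = U P i := by
  have := mk_rel P (BlobRel.adjacent (P := P) i j hi hj h)
  rwa [map_mul, map_mul] at this

lemma U_far (i j : Fin n) (h : i.val + 2 ≤ j.val) : U P i * U P j = U P j * U P i := by
  have := mk_rel P (BlobRel.far (P := P) i j h)
  rwa [map_mul, map_mul] at this

/-- A subspace of a module which is stable under the generators is a submodule. -/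
lemma smul_mem_of_U {D : Type*} [AddCommGroup D] [Module (Blob P n) D] [Module k D]
    [IsScalarTower k (Blob P n) D] (p : Submodule k D)
    (h : ∀ i : Fin n, ∀ d ∈ p, U P i • d ∈ p) (b : Blob P n) : ∀ d ∈ p, b • d ∈ p := by
  obtain ⟨x, rfl⟩ := mk_surjective P n b
  induction x using FreeAlgebra.induction with
  | grade0 c =>
    intro d hd
    rw [AlgHom.commutes, algebraMap_smul]
    exact p.smul_mem c hd
  | grade1 i => exact h i
  | mul x y hx hy =>
    intro d hd
    rw [map_mul, mul_smul]
    exact hx _ (hy d hd)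
  | add x y hx hy =>
    intro d hd
    rw [map_add, add_smul]
    exact p.add_mem (hx d hd) (hy d hd)

/-- The submodule carried by a subspace which is stable under the generators. -/
def submoduleOfU {D : Type*} [AddCommGroup D] [Module (Blob P n) D] [Module k D]
    [IsScalarTower k (Blob P n) D] (p : Submodule k D)
    (h : ∀ i : Fin n, ∀ d ∈ p, U P i • d ∈ p) : Submodule (Blob P n) D where
  carrier := p
  add_mem' := p.add_mem
  zero_mem' := p.zero_mem
  smul_mem' b d := smul_mem_of_U P p h b d

lemma mem_submoduleOfU {D : Type*} [AddCommGroup D] [Module (Blob P n) D] [Module k D]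
    [IsScalarTower k (Blob P n) D] {p : Submodule k D}
    {h : ∀ i : Fin n, ∀ d ∈ p, U P i • d ∈ p} {d : D} : d ∈ submoduleOfU P p h ↔ d ∈ p :=
  Iff.rfl

/-- The last generator. -/
def Ulast (n : ℕ) [NeZero n] : Blob P n := U P ⟨n - 1, Nat.sub_one_lt (NeZero.ne n)⟩

lemma e_eq [NeZero n] : e P n = algebraMap k (Blob P n) (-(gaussInt P.q 2)⁻¹) * Ulast P n := by
  rw [← Algebra.smul_def]; rfl

lemma Ulast_eq [NeZero n] : Ulast P n = algebraMap k (Blob P n) (-(gaussInt P.q 2)) * e P n := by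
  rw [e_eq, ← mul_assoc, ← map_mul, neg_mul_neg, mul_inv_cancel₀ P.gaussInt_two_ne_zero, map_one,
    one_mul]

/-- Induction from the last generator down to the first one. -/
lemma U_smul_induction {D : Type*} [AddCommGroup D] [Module (Blob P n) D] [NeZero n]
    (Q : D → Prop) (hlast : ∀ d : D, Q (Ulast P n • d))
    (hstep : ∀ i j : Fin n, 0 < i.val → i.val + 1 = j.val → ∀ d : D,
      Q (U P j • U P i • d) → Q (U P i • U P j • U P i • d))
    (i : Fin n) (hi : 0 < i.val) (d : D) : Q (U P i • d) := by
  obtain ⟨a, ha⟩ : ∃ a, i.val + a + 1 = n := ⟨n - 1 - i.val, by omega⟩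
  induction a generalizing i d with
  | zero =>
    have : i = ⟨n - 1, Nat.sub_one_lt (NeZero.ne n)⟩ := Fin.ext (by simp; omega)
    rw [this]
    exact hlast d
  | succ a ih =>
    have hj : i.val + 1 < n := by omega
    -- The hypothesis is applied at `d`, and U_i U_{i+1} U_i = U_i collapses the result to U_i d.
    -- Since `Q` is an arbitrary predicate, it can later be membership in a mere `k`-subspace.
    have h := hstep i ⟨i.val + 1, hj⟩ hi rfl d
      (ih ⟨i.val + 1, hj⟩ (Nat.succ_pos _) _ (by simp; omega))
    rwa [← mul_smul, ← mul_smul, U_adjacent P i ⟨i.val + 1, hj⟩ hi (Nat.succ_pos _) (Or.inl rfl)]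
      at h

/-- With e D, a submodule contains U_{n−1} D, and then all U_i D for i ≥ 1 by descending along U_i =
U_i U_{i+1} U_i. -/
lemma U_smul_mem {D : Type*} [AddCommGroup D] [Module (Blob P n) D] [NeZero n]
    (S : Submodule (Blob P n) D) (hS : ∀ d, e P n • d ∈ S) (i : Fin n) (hi : 0 < i.val) (d : D) :
    U P i • d ∈ S := by
  refine U_smul_induction P (· ∈ S) (fun d => ?_) (fun i j _ _ d h => S.smul_mem _ h) i hi d
  rw [Ulast_eq, mul_smul]
  exact S.smul_mem _ (hS d)

/-- The module `D` is generated by `e D`. -/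
def GeneratedByE (n : ℕ) [NeZero n] (D : Type*) [AddCommGroup D] [Module (Blob P n) D] : Prop :=
  ∀ S : Submodule (Blob P n) D, (∀ d, e P n • d ∈ S) → S = ⊤

lemma GeneratedByE.of_surjective [NeZero n] {D D' : Type*} [AddCommGroup D] [Module (Blob P n) D]
    [AddCommGroup D'] [Module (Blob P n) D'] (h : GeneratedByE P n D) (f : D →ₗ[Blob P n] D')
    (hf : Function.Surjective f) : GeneratedByE P n D' := by
  intro S hS
  have := h (S.comap f) fun d => by rw [Submodule.mem_comap, map_smul]; exact hS _
  refine eq_top_iff.mpr fun d' _ => ?_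
  obtain ⟨d, rfl⟩ := hf d'
  exact (this ▸ Submodule.mem_top : d ∈ S.comap f)

end Blob

/-! ### Globalized modules over a ring with an idempotent -/

section Idempotent

variable {B : Type*} [Ring B] {e : B} (he : IsIdempotentElem e)

/-- The element `e` of the left ideal `B e`. -/
def eSpan (e : B) : Ideal.span {e} := ⟨e, Ideal.mem_span_singleton_self e⟩

lemma span_mul_self {e : B} (he : IsIdempotentElem e) (x : Ideal.span {e}) : (x : B) * e = x := by
  obtain ⟨b, hb⟩ := Ideal.mem_span_singleton'.mp x.2
  rw [← hb, mul_assoc, he.eq]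

/-- The element `e v` of `e M`. -/
def LocF.mk {M : Type*} [AddCommGroup M] [Module B M] (v : M) : LocF he M := ⟨e • v, v, rfl⟩

/-- For x in B e the element e x lies in e B e, so it moves across the tensor sign: e x ⊗ y = e ⊗ e
x y. Thus e z depends only on the image of z under the adjointness map, whose kernel is therefore
killed by e. -/
lemma GlobG.e_smul {M : Type*} [AddCommGroup M] [Module B M] (z : GlobG he (LocF he M)) :
    e • z = Submodule.Quotient.mk (eSpan e ⊗ₜ[ℤ] LocF.mk he (adjMap he M z)) := by
  obtain ⟨t, rfl⟩ := Submodule.Quotient.mk_surjective _ z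
  induction t using TensorProduct.induction_on with
  | zero =>
    have : LocF.mk he (0 : M) = 0 := Subtype.ext (smul_zero e)
    simp [this]
  | add x y hx hy =>
    have (v w : M) : LocF.mk he (v + w) = LocF.mk he v + LocF.mk he w :=
      Subtype.ext (smul_add e v w)
    rw [Submodule.Quotient.mk_add, smul_add, hx, hy, map_add, this, TensorProduct.tmul_add]
    rfl
  | tmul x y =>
    let a : he.Corner := ⟨e * x, (Subsemigroup.mem_corner_iff he).mpr
      ⟨by rw [← mul_assoc, he.eq], by rw [mul_assoc, span_mul_self he]⟩⟩
    have h1 : e • x = mulCorner he (eSpan e) a := Subtype.ext (by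
      change e * (x : B) = e * (e * x)
      rw [← mul_assoc, he.eq])
    have h2 : LocF.mk he ((x : B) • (y : M)) = a • y := Subtype.ext (mul_smul e (x : B) (y : M)).symm
    rw [adjMap_mk, h2, ← Submodule.Quotient.mk_smul, TensorProduct.smul_tmul', h1]
    exact (Submodule.Quotient.eq _).mpr (Submodule.subset_span ⟨_, _, _, rfl⟩)

lemma GlobG.e_smul_eq_zero {M : Type*} [AddCommGroup M] [Module B M] (z : GlobG he (LocF he M))
    (hz : adjMap he M z = 0) : e • z = 0 := by
  have : LocF.mk he (0 : M) = 0 := Subtype.ext (smul_zero e)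
  rw [GlobG.e_smul, hz, this, TensorProduct.tmul_zero, Submodule.Quotient.mk_zero]

/-- Each x ⊗ y equals x · e (e ⊗ y), because x e = x for x in B e. -/
lemma GlobG.eq_top {N : Type*} [AddCommGroup N] [Module he.Corner N]
    (S : Submodule B (GlobG he N)) (hS : ∀ z, e • z ∈ S) : S = ⊤ := by
  refine eq_top_iff.mpr fun z _ => ?_
  obtain ⟨t, rfl⟩ := Submodule.Quotient.mk_surjective _ z
  induction t using TensorProduct.induction_on with
  | zero => exact S.zero_mem
  | add x y hx hy => exact S.add_mem (hx trivial) (hy trivial)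
  | tmul x y =>
    have h : x ⊗ₜ[ℤ] y = (x : B) • e • (eSpan e ⊗ₜ[ℤ] y) := by
      rw [TensorProduct.smul_tmul', TensorProduct.smul_tmul']
      congr 1
      refine Subtype.ext ?_
      change (x : B) = x * (e * e)
      rw [he.eq, span_mul_self he]
    rw [h, Submodule.Quotient.mk_smul, Submodule.Quotient.mk_smul]
    exact S.smul_mem _ (hS _)

lemma adjMap_eSpan {M : Type*} [AddCommGroup M] [Module B M] (v : M) :
    adjMap he M (Submodule.Quotient.mk (eSpan e ⊗ₜ[ℤ] LocF.mk he v)) = e • v := by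
  rw [adjMap_mk]
  change e • e • v = e • v
  rw [smul_smul, he.eq]

end Idempotent

/-! ### Globalizations and standard modules are generated by their image under e -/

namespace Blob

variable {k : Type*} [Field k] (P : BlobParams k) {n : ℕ}

lemma GlobG.generatedByE [NeZero n] (hn : 2 ≤ n) (N : Type*) [AddCommGroup N]
    [Module (e_idem P n hn).Corner N] : GeneratedByE P n (GlobG (e_idem P n hn) N) :=
  fun S hS => GlobG.eq_top _ S hS

/-- As soon as there is one factor, the leftmost one is U_{n−1}, a scalar multiple of e. -/
lemma e_mul_cups [NeZero n] (hn : 2 ≤ n) (j : ℕ) : e P n * cups P n (j + 1) = cups P n (j + 1) := by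
  have h0 : 0 < n := by omega
  induction j with
  | zero =>
    have : cups P n (0 + 1) = Ulast P n := by simp [cups, Ulast, h0]
    rw [this, Ulast_eq, ← mul_assoc, ← Algebra.commutes, mul_assoc, (e_idem P n hn).eq]
  | succ j ih => rw [cups, ← mul_assoc, ih]

/-- The bound |λ| + 2 ≤ n makes u a nonempty product, so that e u = u and the generator of Δ_n(λ)
lies in e Δ_n(λ). -/
lemma StandardModule.generatedByE [NeZero n] (hn : 2 ≤ n) (lam : ℤ) (h : lam.natAbs + 2 ≤ n) :
    GeneratedByE P n (StandardModule P n lam) := by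
  intro S hS
  obtain ⟨j, hj⟩ : ∃ j, (n - lam.natAbs) / 2 = j + 1 := ⟨(n - lam.natAbs) / 2 - 1, by omega⟩
  refine eq_top_iff.mpr fun z _ => ?_
  obtain ⟨x, rfl⟩ := Submodule.Quotient.mk_surjective _ z
  obtain ⟨b, hb⟩ := Ideal.mem_span_singleton'.mp x.2
  have hx : x = b • e P n • eSpan (cups P n ((n - lam.natAbs) / 2)) := by
    refine Subtype.ext ?_
    change (x : Blob P n) = b * (e P n * cups P n ((n - lam.natAbs) / 2))
    rw [← hb, hj, e_mul_cups P hn]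
  rw [hx, Submodule.Quotient.mk_smul, Submodule.Quotient.mk_smul]
  exact S.smul_mem _ (hS _)

end Blob

/-! ## Words -/

namespace ATY

variable {n : ℕ}

/-- The sum of the positions of the letters `v₂`. -/
def rank (s : Word n) : ℕ := ∑ j, if s j = 1 then j.val else 0

lemma prev_ne (i : Fin n) (hi : 0 < i.val) : prev i ≠ i := fun e => by
  have := congrArg Fin.val e
  rw [prev_val] at this
  omega

lemma rank_swapW (i : Fin n) (hi : 0 < i.val) (s : Word n) (h0 : s (prev i) = 0)
    (h1 : s i = 1) : rank (swapW i s) + 1 = rank s := by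
  have hne := prev_ne i hi
  have hm : prev i ∈ Finset.univ.erase i := Finset.mem_erase.mpr ⟨hne, Finset.mem_univ _⟩
  unfold rank
  rw [← Finset.add_sum_erase _ _ (Finset.mem_univ i), ← Finset.add_sum_erase _ _ hm,
    ← Finset.add_sum_erase _ (fun j : Fin n => if s j = 1 then j.val else 0) (Finset.mem_univ i),
    ← Finset.add_sum_erase _ (fun j : Fin n => if s j = 1 then j.val else 0) hm]
  have : ∀ x ∈ (Finset.univ.erase i).erase (prev i),
      (if swapW i s x = 1 then x.val else 0) = if s x = 1 then x.val else 0 := by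
    intro x hx
    rw [Finset.mem_erase, Finset.mem_erase] at hx
    rw [swapW_of_ne i s x hx.1 hx.2.1]
  rw [Finset.sum_congr rfl this]
  simp only [swapW_left, swapW_right, h0, h1, prev_val]
  simp
  omega

lemma card_ones {n₁ n₂ : ℕ} (hn : n₁ + n₂ = n) (s : Word n) :
    weight s = (n₁ : ℤ) - n₂ ↔ (Finset.univ.filter fun j => s j = 1).card = n₂ := by
  have h : (Finset.univ.filter fun j => s j = 0).card +
      (Finset.univ.filter fun j => s j = 1).card = n := by
    have h1 : (Finset.univ.filter fun j => s j = 1) = Finset.univ.filter fun j => ¬ s j = 0 := by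
      ext j
      have := Fin2_cases (s j)
      simp only [Finset.mem_filter, Finset.mem_univ, true_and]
      omega
    rw [h1, Finset.card_filter_add_card_filter_not]
    simp
  unfold weight
  omega

lemma weight_eq_iff (s t : Word n) : weight s = weight t ↔
    (Finset.univ.filter fun j => s j = 1).card = (Finset.univ.filter fun j => t j = 1).card := by
  have hle : (Finset.univ.filter fun j => t j = 1).card ≤ n := by
    simpa using Finset.card_filter_le (Finset.univ : Finset (Fin n)) fun j => t j = 1
  have ht := (card_ones (Nat.sub_add_cancel hle) t).mpr rfl
  rw [ht, card_ones (Nat.sub_add_cancel hle) s]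

/-- A function which is invariant under adjacent exchanges is invariant under all exchanges. -/
lemma invariant_swap {β : Type*} (a : ℕ) (h : Word n → β)
    (hinv : ∀ i : Fin n, a < i.val → ∀ s, h (swapW i s) = h s) (x y : Fin n) (hx : a ≤ x.val)
    (hxy : x < y) (s : Word n) : h (s ∘ Equiv.swap x y) = h s := by
  obtain ⟨d, hd⟩ : ∃ d, y.val = x.val + 1 + d := ⟨y.val - x.val - 1, by omega⟩
  induction d generalizing y s with
  | zero =>
    have : x = prev y := Fin.ext (by rw [prev_val]; omega)
    rw [this]
    exact hinv y (by omega) s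
  | succ d ih =>
    have h1 : x ≠ prev y := fun e => by
      have := congrArg Fin.val e; rw [prev_val] at this; omega
    have h2 : x ≠ y := hxy.ne
    -- The transposition of x and y is the conjugate of that of x and y − 1 by the adjacent one of y
    -- − 1 and y.
    have e := Equiv.swap_mul_swap_mul_swap h1 h2
    have : s ∘ Equiv.swap x y = swapW y (swapW y s ∘ Equiv.swap x (prev y)) := by
      rw [Equiv.swap_comm x y, ← e]
      funext j
      simp [swapW]
    rw [this, hinv y (by omega), ih (prev y) (by rw [Fin.lt_def, prev_val]; omega) _
      (by rw [prev_val]; omega), hinv y (by omega)]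

/-- A function which is invariant under the adjacent exchanges beyond the position `a` is constant
on the words with the same weight and the same first `a` letters. -/
lemma eq_of_invariant {β : Type*} (a : ℕ) (h : Word n → β)
    (hinv : ∀ i : Fin n, a < i.val → ∀ s, h (swapW i s) = h s) (s t : Word n)
    (hw : weight s = weight t) (hst : ∀ j : Fin n, j.val < a → s j = t j) : h s = h t := by
  -- Induction on the number of places where the words differ: exchanging a v₂ of `s` that is v₁ in
  -- `t` with a v₁ of `s` that is v₂ in `t` repairs both places, and these lie beyond the common
  -- prefix.
  obtain ⟨N, hN⟩ : ∃ N, (Finset.univ.filter fun j => s j ≠ t j).card = N := ⟨_, rfl⟩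
  induction N using Nat.strong_induction_on generalizing s with
  | _ N ih =>
    by_cases e : s = t
    · rw [e]
    have hcard := (weight_eq_iff s t).mp hw
    -- positions where `s` and `t` differ, in both directions
    have key : ∀ u v : Word n, u ≠ v → (Finset.univ.filter fun j => u j = 1).card =
        (Finset.univ.filter fun j => v j = 1).card → ∃ x, u x = 1 ∧ v x = 0 := by
      intro u v huv hc
      by_contra! hcon
      have hsub : (Finset.univ.filter fun j => u j = 1) ⊆ Finset.univ.filter fun j => v j = 1 := by
        intro j hj
        rw [Finset.mem_filter] at hj ⊢
        exact ⟨hj.1, (Fin2_cases (v j)).resolve_left (hcon j hj.2)⟩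
      have heq := Finset.eq_of_subset_of_card_le hsub hc.ge
      apply huv
      funext j
      have hj := Finset.ext_iff.mp heq j
      simp only [Finset.mem_filter, Finset.mem_univ, true_and] at hj
      rcases Fin2_cases (u j) with h1 | h1 <;> rcases Fin2_cases (v j) with h2 | h2 <;>
        simp_all
    obtain ⟨x, hx1, hx2⟩ := key s t e hcard
    obtain ⟨y, hy2, hy1⟩ := key t s (Ne.symm e) hcard.symm
    have hxa : a ≤ x.val := by
      by_contra! hc
      have := hst x hc
      simp_all
    have hya : a ≤ y.val := by
      by_contra! hc
      have := hst y hc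
      simp_all
    have hxy : x ≠ y := fun e => by simp_all
    have hs' : h (s ∘ Equiv.swap x y) = h s := by
      rcases lt_or_gt_of_ne hxy with hlt | hlt
      · exact invariant_swap a h hinv x y hxa hlt s
      · rw [Equiv.swap_comm]
        exact invariant_swap a h hinv y x hya hlt s
    rw [← hs']
    refine ih _ ?_ _ ?_ ?_ rfl
    · rw [← hN]
      refine Finset.card_lt_card (Finset.ssubset_iff_of_subset ?_ |>.mpr ⟨x, ?_, ?_⟩)
      · intro j hj
        simp only [Finset.mem_filter, Finset.mem_univ, true_and, Function.comp] at hj ⊢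
        by_cases h1 : j = x
        · rw [h1, hx1, hx2]; decide
        by_cases h2 : j = y
        · rw [h2, hy1, hy2]; decide
        rwa [Equiv.swap_apply_of_ne_of_ne h1 h2] at hj
      · simp [hx1, hx2]
      · simp [hx2, hy1]
    · rw [← hw, weight_eq_iff]
      simp only [Finset.card_filter]
      exact Equiv.sum_comp (Equiv.swap x y) fun j => if s j = 1 then 1 else 0
    · intro j hj
      have h1 : j ≠ x := fun e => by subst e; omega
      have h2 : j ≠ y := fun e => by subst e; omega
      rw [Function.comp, Equiv.swap_apply_of_ne_of_ne h1 h2]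
      exact hst j hj

lemma swapW_comm (i j : Fin n) (hi : 0 < i.val) (h : i.val + 2 ≤ j.val) (s : Word n) :
    swapW i (swapW j s) = swapW j (swapW i s) := by
  have h1 : i ≠ j := fun e => by subst e; omega
  have h2 : i ≠ prev j := fun e => by
    have := congrArg Fin.val e; rw [prev_val] at this; omega
  have h3 : prev i ≠ j := fun e => by
    have := congrArg Fin.val e; rw [prev_val] at this; omega
  have h4 : prev i ≠ prev j := fun e => by
    have := congrArg Fin.val e; rw [prev_val, prev_val] at this; omega
  funext x
  simp only [swapW_apply]
  split_ifs <;> simp_all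

/-- A compatible system of increments along the exchanges of adjacent letters is a (twisted)
gradient. -/
lemma exists_potential {k : Type*} [Field k] (q : k) (d : Fin n → Word n → k)
    (hcomm : ∀ i j : Fin n, 0 < i.val → i.val + 2 ≤ j.val → ∀ s : Word n, s (prev i) = 1 →
      s i = 0 → s (prev j) = 1 → s j = 0 →
      d i (swapW j s) - q * d i s = d j (swapW i s) - q * d j s) :
    ∃ g : Word n → k, ∀ i : Fin n, 0 < i.val → ∀ s : Word n, s (prev i) = 0 → s i = 1 →
      g s = q * g (swapW i s) + d i (swapW i s) := by
  -- the potential on words of bounded rank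
  have bounded : ∀ N : ℕ, ∀ g : Word n → k, (∀ i : Fin n, 0 < i.val → ∀ s : Word n,
      rank s ≤ N → s (prev i) = 0 → s i = 1 → g s = q * g (swapW i s) + d i (swapW i s)) →
      ∀ i j : Fin n, 0 < i.val → i.val + 2 ≤ j.val → ∀ s : Word n, rank s = N + 1 →
        s (prev i) = 0 → s i = 1 → s (prev j) = 0 → s j = 1 →
        q * g (swapW i s) + d i (swapW i s) = q * g (swapW j s) + d j (swapW j s) := by
    intro N g hg i j hi hij s hs hi0 hi1 hj0 hj1
    have n1 : i ≠ j := fun e => by subst e; omega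
    have n2 : i ≠ prev j := fun e => by
      have := congrArg Fin.val e; rw [prev_val] at this; omega
    have n3 : prev i ≠ j := fun e => by
      have := congrArg Fin.val e; rw [prev_val] at this; omega
    have n4 : prev i ≠ prev j := fun e => by
      have := congrArg Fin.val e; rw [prev_val, prev_val] at this; omega
    have ri := rank_swapW i hi s hi0 hi1
    have rj := rank_swapW j (by omega) s hj0 hj1
    have e1 := hg j (by omega) (swapW i s) (by omega)
      (by rw [swapW_of_ne i s _ n4.symm n2.symm, hj0]) (by rw [swapW_of_ne i s _ n3.symm n1.symm, hj1])
    have e2 := hg i hi (swapW j s) (by omega)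
      (by rw [swapW_of_ne j s _ n4 n3, hi0]) (by rw [swapW_of_ne j s _ n2 n1, hi1])
    have hsw := swapW_comm i j hi hij s
    have hc := hcomm i j hi hij (swapW i (swapW j s)) (by rw [swapW_left, swapW_of_ne j s _ n2 n1, hi1])
      (by rw [swapW_right, swapW_of_ne j s _ n4 n3, hi0])
      (by rw [hsw, swapW_left, swapW_of_ne i s _ n3.symm n1.symm, hj1])
      (by rw [hsw, swapW_right, swapW_of_ne i s _ n4.symm n2.symm, hj0])
    rw [swapW_swapW] at hc
    rw [hsw, swapW_swapW] at hc
    rw [hsw] at e2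
    rw [e1, e2]
    linear_combination hc
  have main : ∀ N : ℕ, ∃ g : Word n → k, ∀ i : Fin n, 0 < i.val → ∀ s : Word n,
      rank s ≤ N → s (prev i) = 0 → s i = 1 → g s = q * g (swapW i s) + d i (swapW i s) := by
    classical
    intro N
    induction N with
    | zero =>
      refine ⟨0, fun i hi s hs h0 h1 => ?_⟩
      have := rank_swapW i hi s h0 h1
      omega
    | succ N ih =>
      obtain ⟨g, hg⟩ := ih
      -- A word above rank N with some adjacent v₁v₂ takes the value forced by one chosen such
      -- place. A word without any is unconstrained and gets 0. Only rank N + 1 matters at this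
      -- stage.
      refine ⟨fun s => if rank s ≤ N then g s else
        if h : ∃ i : Fin n, 0 < i.val ∧ s (prev i) = 0 ∧ s i = 1 then
          q * g (swapW h.choose s) + d h.choose (swapW h.choose s) else 0, ?_⟩
      intro i hi s hs h0 h1
      have hr := rank_swapW i hi s h0 h1
      have hr' : rank (swapW i s) ≤ N := by omega
      beta_reduce
      rw [if_pos hr']
      by_cases hsN : rank s ≤ N
      · rw [if_pos hsN]
        exact hg i hi s hsN h0 h1
      have hex : ∃ i : Fin n, 0 < i.val ∧ s (prev i) = 0 ∧ s i = 1 := ⟨i, hi, h0, h1⟩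
      rw [if_neg hsN, dif_pos hex]
      obtain ⟨hc, hc0, hc1⟩ := hex.choose_spec
      generalize hex.choose = c at hc hc0 hc1
      have hsr : rank s = N + 1 := by omega
      -- The chosen place `c` may differ from `i`, but two occurrences of v₁v₂ cannot overlap, so
      -- they are at distance at least 2 and `bounded` reconciles them. This is why only far
      -- commutation is needed, and no condition for neighbouring exchanges.
      rcases lt_trichotomy c.val i.val with hlt | heq | hlt
      · have : c.val + 2 ≤ i.val := by
          by_contra! hcon
          have : prev i = c := Fin.ext (by rw [prev_val]; omega)
          rw [this, hc1] at h0
          exact absurd h0 (by decide)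
        exact bounded N g hg c i hc this s hsr hc0 hc1 h0 h1
      · rw [Fin.ext heq]
      · have : i.val + 2 ≤ c.val := by
          by_contra! hcon
          have : prev c = i := Fin.ext (by rw [prev_val]; omega)
          rw [this, h1] at hc0
          exact absurd hc0 (by decide)
        exact (bounded N g hg i c hi this s hsr h0 h1 hc0 hc1).symm
  -- No word has rank above the sum of all positions, so with this bound the restriction on the rank
  -- is void.
  obtain ⟨g, hg⟩ := main (∑ j : Fin n, j.val)
  refine ⟨g, fun i hi s => hg i hi s (Finset.sum_le_sum fun j _ => ?_)⟩
  split_ifs <;> omega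

end ATY

/-! ## Symmetric functionals -/

noncomputable section

namespace ATY

variable {k : Type*} [Field k] (P : BlobParams k) {n : ℕ}

/-- The functional on the tensor space on which all `T_i`, `i ≥ 2`, act by `q`. -/
def symFun (n : ℕ) : TensorSpace P n →ₗ[k] k :=
  (wordBasis P n).constr k fun s => P.q ^ rank s

/-- The part of `symFun` supported by the words with first letter `v₁`. -/
def symFun₁ (n : ℕ) [NeZero n] : TensorSpace P n →ₗ[k] k :=
  (wordBasis P n).constr k fun s => if s 0 = 0 then P.q ^ rank s else 0

lemma symFun_vec (s : Word n) : symFun P n (vec P s) = P.q ^ rank s := by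
  rw [← wordBasis_apply]
  exact (wordBasis P n).constr_basis k _ s

lemma symFun₁_vec [NeZero n] (s : Word n) :
    symFun₁ P n (vec P s) = if s 0 = 0 then P.q ^ rank s else 0 := by
  rw [← wordBasis_apply]
  exact (wordBasis P n).constr_basis k _ s

lemma functional_ext {f g : TensorSpace P n →ₗ[k] k} (h : ∀ s : Word n, f (vec P s) = g (vec P s)) :
    f = g :=
  (wordBasis P n).ext h

lemma E_zero_one (i : Fin n) (s : Word n) (h0 : s (prev i) = 0) (h1 : s i = 1) :
    E P i (vec P s) = vec P (swapW i s) - P.q⁻¹ • vec P s := by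
  rw [E, LinearMap.sub_apply, T_zero_one P i s h0 h1, LinearMap.smul_apply, Module.End.one_apply]
  module

lemma E_one_zero (i : Fin n) (s : Word n) (h1 : s (prev i) = 1) (h0 : s i = 0) :
    E P i (vec P s) = vec P (swapW i s) - P.q • vec P s := by
  rw [E, LinearMap.sub_apply, T_one_zero P i s h1 h0, LinearMap.smul_apply, Module.End.one_apply]

lemma E_zero_one_eq_smul (i : Fin n) (s : Word n) (h0 : s (prev i) = 0) (h1 : s i = 1) :
    E P i (vec P s) = -P.q⁻¹ • E P i (vec P (swapW i s)) := by
  have hq := P.q_ne_zero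
  rw [E_zero_one P i s h0 h1, E_one_zero P i _ (by rw [swapW_left, h1]) (by rw [swapW_right, h0]),
    swapW_swapW]
  match_scalars <;> field_simp

/-- On v₂v₁ the operator `E` is the exchange minus q, and the exchange to v₁v₂ raises the rank by
one. The value on v₁v₂ is proportional to that on v₂v₁. -/
lemma symFun_E (i : Fin n) (hi : 0 < i.val) (v : TensorSpace P n) : symFun P n (E P i v) = 0 := by
  have hq := P.q_ne_zero
  have key : ∀ s : Word n, s (prev i) = 1 → s i = 0 → symFun P n (E P i (vec P s)) = 0 := by
    intro s h1 h0
    have hr := rank_swapW i hi (swapW i s) (by rw [swapW_left, h0]) (by rw [swapW_right, h1])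
    rw [swapW_swapW] at hr
    rw [E_one_zero P i s h1 h0, map_sub, map_smul, symFun_vec, symFun_vec, ← hr, smul_eq_mul]
    ring
  suffices h : symFun P n ∘ₗ E P i = 0 from LinearMap.congr_fun h v
  refine functional_ext P fun s => ?_
  rw [LinearMap.comp_apply, LinearMap.zero_apply]
  rcases Fin2_cases (s (prev i)) with h1 | h1 <;> rcases Fin2_cases (s i) with h2 | h2
  · rw [E_same P i s (by rw [h1, h2]), map_zero]
  · rw [E_zero_one_eq_smul P i s h1 h2, map_smul,
      key _ (by rw [swapW_left, h2]) (by rw [swapW_right, h1]), smul_zero]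
  · exact key s h1 h2
  · rw [E_same P i s (by rw [h1, h2]), map_zero]

/-- For i ≥ 2 the first letter is untouched, so the computation for `symFun` restricts to the words
beginning with v₁. -/
lemma symFun₁_E [NeZero n] (i : Fin n) (hi : 2 ≤ i.val) (v : TensorSpace P n) :
    symFun₁ P n (E P i v) = 0 := by
  have hi0 : (0 : Fin n) ≠ i := fun e => by
    have := congrArg Fin.val e; rw [Fin.val_zero] at this; omega
  have hi1 : (0 : Fin n) ≠ prev i := fun e => by
    have := congrArg Fin.val e; rw [Fin.val_zero, prev_val] at this; omega
  suffices h : symFun₁ P n ∘ₗ E P i = 0 from LinearMap.congr_fun h v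
  refine functional_ext P fun s => ?_
  rw [LinearMap.comp_apply, LinearMap.zero_apply]
  have h1 := symFun_E P i (by omega) (vec P s)
  have hsw := swapW_of_ne i s 0 hi1 hi0
  rw [E_eq, loc_vec P] at h1 ⊢
  rw [map_add, map_smul, map_smul, symFun_vec, symFun_vec] at h1
  rw [map_add, map_smul, map_smul, symFun₁_vec, symFun₁_vec, hsw]
  split_ifs at h1 ⊢ <;> simp_all

lemma symFun_Tinv (i : Fin n) (hi : 0 < i.val) (v : TensorSpace P n) :
    symFun P n (Tinv P i v) = P.q⁻¹ * symFun P n v := by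
  have h := symFun_E P i hi v
  rw [E, LinearMap.sub_apply, LinearMap.smul_apply, Module.End.one_apply, map_sub, map_smul,
    smul_eq_mul] at h
  rw [Tinv_eq P i hi, LinearMap.sub_apply, LinearMap.smul_apply, Module.End.one_apply, map_sub,
    map_smul, smul_eq_mul]
  linear_combination h

/-- Follow the letter v₁ at `p` to the right. Each T⁻¹ contributes q⁻¹. Passing a v₁, the operator S
contributes q, which cancels this; passing a v₂, S moves that v₂ one place to the left and the drop
in rank contributes a second q⁻¹. So each v₂ beyond `p` costs q⁻². -/
lemma symFun_C (d : ℕ) : ∀ (p : Fin n), n = p.val + 1 + d → ∀ s : Word n, s p = 0 →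
    symFun P n (C P n (p.val + 1) (vec P s)) =
      (P.q⁻¹ ^ 2) ^ (Finset.univ.filter fun j => p < j ∧ s j = 1).card * P.q ^ rank s := by
  have h0 := P.q_ne_zero
  induction d with
  | zero =>
    intro p hp s hsp
    have : (Finset.univ.filter fun j => p < j ∧ s j = 1) = ∅ := by
      refine Finset.filter_eq_empty_iff.mpr fun j _ hj => ?_
      have := Fin.lt_def.mp hj.1
      omega
    rw [C_end P _ (by omega), this, Module.End.one_apply, symFun_vec]
    simp
  | succ d ih =>
    intro p hp s hsp
    obtain ⟨b, hb⟩ : ∃ b : Fin n, b = ⟨p.val + 1, by omega⟩ := ⟨_, rfl⟩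
    have hbv : b.val = p.val + 1 := by rw [hb]
    have hb0 : 0 < b.val := by omega
    have hpb : prev b = p := Fin.ext (by simp [prev, hbv])
    have hcard : ∀ t : Word n, (∀ j, b < j → t j = s j) →
        (Finset.univ.filter fun j => p < j ∧ s j = 1).card =
        (Finset.univ.filter fun j => b < j ∧ t j = 1).card + if s b = 1 then 1 else 0 := by
      intro t ht
      have hnot : b ∉ Finset.univ.filter fun j => b < j ∧ t j = 1 := by simp
      have hiff : ∀ j, p < j ↔ j = b ∨ b < j := fun j => by
        rw [Fin.lt_def, Fin.lt_def, Fin.ext_iff]; omega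
      split_ifs with hsb
      · rw [← Finset.card_insert_of_notMem hnot]
        congr 1
        ext j
        simp only [Finset.mem_filter, Finset.mem_univ, true_and, Finset.mem_insert, hiff]
        constructor
        · rintro ⟨rfl | hj, h1⟩
          · exact Or.inl rfl
          · exact Or.inr ⟨hj, (ht j hj).trans h1⟩
        · rintro (rfl | ⟨hj, h1⟩)
          · exact ⟨Or.inl rfl, hsb⟩
          · exact ⟨Or.inr hj, (ht j hj).symm.trans h1⟩
      · rw [add_zero]
        congr 1
        ext j
        simp only [Finset.mem_filter, Finset.mem_univ, true_and, hiff]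
        constructor
        · rintro ⟨rfl | hj, h1⟩
          · exact absurd h1 hsb
          · exact ⟨hj, (ht j hj).trans h1⟩
        · rintro ⟨hj, h1⟩
          exact ⟨Or.inr hj, (ht j hj).symm.trans h1⟩
    rw [C_step P _ (by omega : p.val + 1 < n), ← hb]
    have ihb := ih b (by omega)
    rw [hbv] at ihb
    simp only [Module.End.mul_apply]
    rw [symFun_Tinv P b hb0]
    rcases Fin2_cases (s b) with hsb | hsb
    · rw [S_same P b s (by rw [hpb, hsp, hsb]), map_smul, map_smul, ihb s hsb,
        hcard s fun _ _ => rfl, hsb, smul_eq_mul]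
      simp only [zero_ne_one, if_false, add_zero]
      field_simp
    · have hr := rank_swapW b hb0 s (by rw [hpb, hsp]) hsb
      rw [S_ne P b s (by rw [hpb, hsp, hsb]; decide),
        ihb (swapW b s) (by rw [swapW_right, hpb, hsp]), hcard (swapW b s) fun j hj =>
          swapW_of_ne b s j (by rw [hpb, Ne, Fin.ext_iff]; have := Fin.lt_def.mp hj; omega) hj.ne',
        if_pos hsb, ← hr, pow_succ _ (Finset.card _), pow_succ P.q]
      generalize (P.q⁻¹ ^ 2) ^ (Finset.card _) = c
      field_simp

lemma symFun_X_zero [NeZero n] (s : Word n) (h : s 0 = 0) :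
    symFun P n (X P (vec P s)) = P.lam₁ *
      (P.q⁻¹ ^ 2) ^ (Finset.univ.filter fun j => s j = 1).card * P.q ^ rank s := by
  have hn : 0 < n := Nat.pos_of_ne_zero (NeZero.ne n)
  have hb := symFun_C P (n - 1) (0 : Fin n) (by simp; omega) s h
  simp only [Fin.val_zero, zero_add] at hb
  have hc : (Finset.univ.filter fun j => 0 < j ∧ s j = 1) = Finset.univ.filter fun j => s j = 1 := by
    refine Finset.filter_congr fun j _ => ⟨And.right, fun hj => ⟨?_, hj⟩⟩
    refine Fin.pos_iff_ne_zero.mpr fun e => ?_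
    rw [e, h] at hj
    exact absurd hj (by decide)
  rw [X_eq, Module.End.mul_apply, varpi_vec, if_pos h, map_smul, map_smul, hb, hc, smul_eq_mul,
    mul_assoc]

lemma symFun_X_one [NeZero n] (s : Word n) (h : s 0 = 1) :
    symFun P n (X P (vec P s)) = P.lam₂ * P.q ^ rank s := by
  rw [X_one P s h, map_smul, symFun_vec, smul_eq_mul]

/-- Modulo the words beginning with v₂, on which `symFun₁` vanishes, X is multiplication by λ₁; the
span of these words is stable under X. -/
lemma symFun₁_X [NeZero n] (v : TensorSpace P n) :
    symFun₁ P n (X P v) = P.lam₁ * symFun₁ P n v := by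
  suffices h : symFun₁ P n ∘ₗ X P = P.lam₁ • symFun₁ P n from LinearMap.congr_fun h v
  refine functional_ext P fun s => ?_
  rw [LinearMap.comp_apply, LinearMap.smul_apply, smul_eq_mul]
  rcases Fin2_cases (s 0) with h | h
  · have hle : Y P s 0 ≤ LinearMap.ker (symFun₁ P n) := by
      refine Submodule.span_le.mpr ?_
      rintro _ ⟨t, rfl, h1, -⟩
      simp [symFun₁_vec, h1]
    have := hle (X_zero P s h)
    rw [LinearMap.mem_ker, map_sub, map_smul, sub_eq_zero] at this
    exact this
  · rw [X_one P s h, map_smul, symFun₁_vec]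
    simp [h]

lemma symFun₁_E₀ [NeZero n] (v : TensorSpace P n) : symFun₁ P n (E₀ P v) = 0 := by
  rw [E₀_apply, map_sub, map_smul, symFun₁_X, smul_eq_mul, sub_self]

/-! ## The permutation modules -/

section Perm

variable [NeZero n] {lam : ℤ}

/-- The inclusion of a permutation module, as a `k`-linear map. -/
def incl (n : ℕ) [NeZero n] (lam : ℤ) : M P n lam →ₗ[k] TensorSpace P n :=
  (M P n lam).subtype.restrictScalars k

lemma incl_U_zero (i : Fin n) (hi : i.val = 0) (v : M P n lam) :
    incl P n lam (Blob.U P i • v) = E₀ P (incl P n lam v) := by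
  rw [← opU_zero P i hi, ← rep_U]
  rfl

lemma incl_U_pos (i : Fin n) (hi : 0 < i.val) (v : M P n lam) :
    incl P n lam (Blob.U P i • v) = E P i (incl P n lam v) := by
  rw [← opU_pos P i hi, ← rep_U]
  rfl

/-- The words as elements of a permutation module. -/
def word (s : Word n) (hs : weight s = lam) : M P n lam := ⟨vec P s, vec_mem_W P hs⟩

lemma incl_word (s : Word n) (hs : weight s = lam) : incl P n lam (word P s hs) = vec P s := rfl

lemma perm_ext {f g : M P n lam →ₗ[k] k}
    (h : ∀ s (hs : weight s = lam), f (word P s hs) = g (word P s hs)) : f = g := by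
  have hle : W P n lam ≤ (LinearMap.ker (f - g)).map (incl P n lam) := by
    refine Submodule.span_le.mpr ?_
    rintro _ ⟨s, hs, rfl⟩
    exact ⟨word P s hs, by simp [h s hs], rfl⟩
  refine LinearMap.ext fun v => ?_
  obtain ⟨w, hw, he⟩ := hle v.2
  have : w = v := Subtype.ext he
  rw [← this]
  exact sub_eq_zero.mp hw

lemma incl_injective : Function.Injective (incl P n lam) := Subtype.val_injective

lemma U_word_same (i : Fin n) (hi : 0 < i.val) (s : Word n) (hs : weight s = lam)
    (h : s (prev i) = s i) : Blob.U P i • word P s hs = 0 :=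
  incl_injective P (by rw [incl_U_pos P i hi, incl_word, E_same P i s h, map_zero])

lemma U_word_one_zero (i : Fin n) (hi : 0 < i.val) (s : Word n) (hs : weight s = lam)
    (h1 : s (prev i) = 1) (h0 : s i = 0) : Blob.U P i • word P s hs =
      word P (swapW i s) ((weight_swapW i s).trans hs) - P.q • word P s hs :=
  incl_injective P (by rw [incl_U_pos P i hi, incl_word, E_one_zero P i s h1 h0, map_sub, map_smul,
    incl_word, incl_word])

lemma U_word_zero_one (i : Fin n) (hi : 0 < i.val) (s : Word n) (hs : weight s = lam)
    (h0 : s (prev i) = 0) (h1 : s i = 1) : Blob.U P i • word P s hs =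
      -P.q⁻¹ • Blob.U P i • word P (swapW i s) ((weight_swapW i s).trans hs) :=
  incl_injective P (by rw [map_smul (incl P n lam) (-P.q⁻¹), incl_U_pos P i hi, incl_U_pos P i hi, incl_word, incl_word,
    E_zero_one_eq_smul P i s h0 h1])

/-- A functional which vanishes on `U_i M` for `i > a` is proportional to `symFun` on the words with
the same first `a` letters. -/
lemma functional_mul_eq (a : ℕ) (f : M P n lam →ₗ[k] k)
    (hf : ∀ i : Fin n, a < i.val → ∀ v, f (Blob.U P i • v) = 0) (s t : Word n)
    (hs : weight s = lam) (ht : weight t = lam) (hst : ∀ j : Fin n, j.val < a → s j = t j) :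
    f (word P s hs) * P.q ^ rank t = f (word P t ht) * P.q ^ rank s := by
  classical
  have hq := P.q_ne_zero
  -- Vanishing on U_i M forces a factor q for every exchange of v₂v₁ into v₁v₂, which is also the
  -- change of q^rank. Hence the quotient is invariant under the exchanges beyond `a`.
  let h : Word n → k := fun u =>
    if hu : weight u = lam then f (word P u hu) / P.q ^ rank u else 0
  have key : ∀ i : Fin n, a < i.val → ∀ u : Word n, u (prev i) = 1 → u i = 0 →
      h (swapW i u) = h u := by
    intro i hi u h1 h0
    by_cases hu : weight u = lam
    · have hr := rank_swapW i (by omega) (swapW i u) (by rw [swapW_left, h0])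
        (by rw [swapW_right, h1])
      rw [swapW_swapW] at hr
      have hz := hf i hi (word P u hu)
      rw [U_word_one_zero P i (by omega) u hu h1 h0, map_sub, map_smul, sub_eq_zero,
        smul_eq_mul] at hz
      have hu' : weight (swapW i u) = lam := (weight_swapW i u).trans hu
      simp only [h, dif_pos hu, dif_pos hu', hz, ← hr, pow_succ]
      field_simp
    · have hu' : ¬ weight (swapW i u) = lam := by rwa [weight_swapW]
      simp only [h, dif_neg hu, dif_neg hu']
  have hinv : ∀ i : Fin n, a < i.val → ∀ u, h (swapW i u) = h u := by
    intro i hi u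
    rcases Fin2_cases (u (prev i)) with h1 | h1 <;> rcases Fin2_cases (u i) with h2 | h2
    · congr 1
      funext j
      rw [swapW_apply]
      split_ifs <;> simp_all
    · have := key i hi (swapW i u) (by rw [swapW_left, h2]) (by rw [swapW_right, h1])
      rw [swapW_swapW] at this
      exact this.symm
    · exact key i hi u h1 h2
    · congr 1
      funext j
      rw [swapW_apply]
      split_ifs <;> simp_all
  have := eq_of_invariant a h hinv s t (hs.trans ht.symm) hst
  simp only [h, dif_pos hs, dif_pos ht] at this
  rwa [div_eq_div_iff (pow_ne_zero _ hq) (pow_ne_zero _ hq)] at this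

/-- The restriction of `symFun` to a permutation module. -/
def permFun (n : ℕ) [NeZero n] (lam : ℤ) : M P n lam →ₗ[k] k :=
  symFun P n ∘ₗ incl P n lam

/-- The restriction of `symFun₁` to a permutation module. -/
def permFun₁ (n : ℕ) [NeZero n] (lam : ℤ) : M P n lam →ₗ[k] k :=
  symFun₁ P n ∘ₗ incl P n lam

lemma permFun_word (s : Word n) (hs : weight s = lam) :
    permFun P n lam (word P s hs) = P.q ^ rank s := symFun_vec P s

lemma permFun₁_word (s : Word n) (hs : weight s = lam) :
    permFun₁ P n lam (word P s hs) = if s 0 = 0 then P.q ^ rank s else 0 := symFun₁_vec P s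

lemma permFun_U (i : Fin n) (hi : 0 < i.val) (v : M P n lam) :
    permFun P n lam (Blob.U P i • v) = 0 := by
  rw [permFun, LinearMap.comp_apply, incl_U_pos P i hi, symFun_E P i hi]

lemma permFun₁_U_zero (v : M P n lam) : permFun₁ P n lam (Blob.U P (0 : Fin n) • v) = 0 := by
  rw [permFun₁, LinearMap.comp_apply, incl_U_zero P 0 rfl, symFun₁_E₀]

/-- On words beginning with v₂, X is the scalar λ₂. On those beginning with v₁, `symFun` picks up λ₁
and a factor q⁻² for each of the n₂ letters v₂. The difference of these two eigenvalues is the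
coefficient of `permFun₁`. -/
lemma permFun_U_zero {n₁ n₂ : ℕ} (hn : n₁ + n₂ = n) (v : M P n ((n₁ : ℤ) - n₂)) :
    permFun P n _ (Blob.U P (0 : Fin n) • v) =
      (P.lam₁ * (P.q⁻¹ ^ 2) ^ n₂ - P.lam₂) * permFun₁ P n _ v
        + (P.lam₂ - P.lam₁) * permFun P n _ v := by
  suffices h : permFun P n ((n₁ : ℤ) - n₂) ∘ₗ (Module.toModuleEnd k (S := Blob P n) (M P n _)
      (Blob.U P (0 : Fin n))) =
      (P.lam₁ * (P.q⁻¹ ^ 2) ^ n₂ - P.lam₂) • permFun₁ P n _ +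
        (P.lam₂ - P.lam₁) • permFun P n _ from LinearMap.congr_fun h v
  refine perm_ext P fun s hs => ?_
  change permFun P n ((n₁ : ℤ) - n₂) (Blob.U P (0 : Fin n) • word P s hs) = _ * _ + _ * _
  rw [permFun_word, permFun₁_word, permFun, LinearMap.comp_apply, incl_U_zero P 0 rfl, incl_word,
    E₀_apply, map_sub, map_smul, symFun_vec, smul_eq_mul]
  rcases Fin2_cases (s 0) with h | h
  · rw [symFun_X_zero P s h, (card_ones hn s).mp hs, if_pos h]
    ring
  · rw [symFun_X_one P s h, if_neg (by rw [h]; decide)]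
    ring

/-- A word beginning with v₁v₂; exchanging its first two letters gives one of the same weight
beginning with v₂, so both first letters occur. -/
lemma exists_word {n₁ n₂ : ℕ} (hn : n₁ + n₂ = n) (h1 : 0 < n₁) (h2 : 0 < n₂) :
    ∃ s : Word n, weight s = (n₁ : ℤ) - n₂ ∧ s 0 = 0 ∧ ∀ i : Fin n, i.val = 1 → s i = 1 := by
  refine ⟨fun j => if 0 < j.val ∧ j.val ≤ n₂ then 1 else 0, ?_, by simp, fun i hi => ?_⟩
  · rw [card_ones hn]
    have : (Finset.univ.filter fun j : Fin n =>
        (if 0 < j.val ∧ j.val ≤ n₂ then (1 : Fin 2) else 0) = 1) =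
        Finset.Ioc (⟨0, by omega⟩ : Fin n) ⟨n₂, by omega⟩ := by
      ext j
      simp only [Finset.mem_filter, Finset.mem_univ, true_and, Finset.mem_Ioc, Fin.lt_def,
        Fin.le_def]
      split_ifs with h
      · exact iff_of_true rfl h
      · exact iff_of_false (by decide) h
    rw [this, Fin.card_Ioc]
    simp
  · exact if_pos (by omega)

/-- Functionals vanishing on all `U_i M`, `i ≥ 1`. -/
lemma eq_smul_permFun {n₁ n₂ : ℕ} (hn : n₁ + n₂ = n) (h1 : 0 < n₁) (h2 : 0 < n₂)
    (f : M P n ((n₁ : ℤ) - n₂) →ₗ[k] k)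
    (hf : ∀ i : Fin n, 0 < i.val → ∀ v, f (Blob.U P i • v) = 0) :
    ∃ a : k, ∀ v, f v = a * permFun P n _ v := by
  obtain ⟨s, hs, -, -⟩ := exists_word hn h1 h2
  have hq := pow_ne_zero (rank s) P.q_ne_zero
  refine ⟨f (word P s hs) / P.q ^ rank s, fun v => ?_⟩
  suffices h : f = (f (word P s hs) / P.q ^ rank s) • permFun P n _ from
    LinearMap.congr_fun h v
  refine perm_ext P fun t ht => ?_
  have := functional_mul_eq P 0 f hf s t hs ht fun j hj => absurd hj (Nat.not_lt_zero _)
  rw [LinearMap.smul_apply, permFun_word, smul_eq_mul, div_mul_eq_mul_div, this]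
  field_simp

/-- Functionals vanishing on all `U_i M`, `i ≥ 2`. -/
lemma eq_combination_permFun {n₁ n₂ : ℕ} (hn : n₁ + n₂ = n) (h1 : 0 < n₁) (h2 : 0 < n₂)
    (f : M P n ((n₁ : ℤ) - n₂) →ₗ[k] k)
    (hf : ∀ i : Fin n, 1 < i.val → ∀ v, f (Blob.U P i • v) = 0) :
    ∃ a b : k, ∀ v, f v = a * permFun₁ P n _ v + b * permFun P n _ v := by
  obtain ⟨s, hs, hs0, hs1⟩ := exists_word hn h1 h2
  have hn2 : 1 < n := by omega
  let t := swapW (⟨1, hn2⟩ : Fin n) s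
  have ht : weight t = (n₁ : ℤ) - n₂ := (weight_swapW _ s).trans hs
  have ht0 : t 0 = 1 := by
    have : (0 : Fin n) = prev ⟨1, hn2⟩ := Fin.ext (by simp [prev])
    rw [this]
    exact (swapW_left _ s).trans (hs1 _ rfl)
  have hqs := pow_ne_zero (rank s) P.q_ne_zero
  have hqt := pow_ne_zero (rank t) P.q_ne_zero
  -- The values of f, normalized by q^rank, are one constant on the words beginning with v₁ and
  -- another on those beginning with v₂. The second is the coefficient of `permFun`, and their
  -- difference that of `permFun₁`.
  refine ⟨f (word P s hs) / P.q ^ rank s - f (word P t ht) / P.q ^ rank t,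
    f (word P t ht) / P.q ^ rank t, fun v => ?_⟩
  suffices h : f = (f (word P s hs) / P.q ^ rank s - f (word P t ht) / P.q ^ rank t) •
      permFun₁ P n _ + (f (word P t ht) / P.q ^ rank t) • permFun P n _ from
    LinearMap.congr_fun h v
  refine perm_ext P fun u hu => ?_
  rw [LinearMap.add_apply, LinearMap.smul_apply, LinearMap.smul_apply, permFun_word, permFun₁_word,
    smul_eq_mul, smul_eq_mul]
  have h0 : ∀ j : Fin n, j.val < 1 → j = 0 := fun j hj => Fin.ext (by rw [Fin.val_zero]; omega)
  rcases Fin2_cases (u 0) with h | h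
  · have := functional_mul_eq P 1 f hf s u hs hu fun j hj => by rw [h0 j hj, hs0, h]
    rw [if_pos h, sub_mul, sub_add_cancel, div_mul_eq_mul_div, this]
    field_simp
  · have := functional_mul_eq P 1 f hf t u ht hu fun j hj => by rw [h0 j hj, ht0, h]
    rw [if_neg (by rw [h]; decide), mul_zero, zero_add, div_mul_eq_mul_div, this]
    field_simp

/-- Triviality of the extensions of a permutation module by the one-dimensional module of the
Temperley-Lieb algebra, in terms of cocycles. -/
lemma exists_primitive (θ : Fin n → M P n lam →ₗ[k] k)
    (hsq : ∀ i : Fin n, 0 < i.val → ∀ v, θ i (Blob.U P i • v) = -gaussInt P.q 2 * θ i v)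
    (hcomm : ∀ i j : Fin n, 0 < i.val → i.val + 2 ≤ j.val → ∀ v,
      θ i (Blob.U P j • v) = θ j (Blob.U P i • v)) :
    ∃ g : M P n lam →ₗ[k] k, ∀ i : Fin n, 0 < i.val → ∀ v, θ i v = g (Blob.U P i • v) := by
  classical
  have hq := P.q_ne_zero
  have h2 := P.gaussInt_two_ne_zero
  -- The increment at `i` is the value of `θ i` on a word reading v₂v₁ there, and the commutation
  -- relation for distant generators is exactly its compatibility.
  obtain ⟨g, hg⟩ := exists_potential P.q
    (fun i s => if hs : weight s = lam then θ i (word P s hs) else 0) (by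
      intro i j hi hij s hi1 hi0 hj1 hj0
      by_cases hs : weight s = lam
      · have hs' : ∀ a, weight (swapW a s) = lam := fun a => (weight_swapW a s).trans hs
        have := hcomm i j hi hij (word P s hs)
        rw [U_word_one_zero P i hi s hs hi1 hi0, U_word_one_zero P j (by omega) s hs hj1 hj0,
          map_sub, map_sub, map_smul, map_smul, smul_eq_mul, smul_eq_mul] at this
        simpa only [dif_pos hs, dif_pos (hs' _)] using this
      · have hs' : ∀ a, ¬ weight (swapW a s) = lam := fun a => by rwa [weight_swapW]
        simp only [dif_neg hs, dif_neg (hs' _), mul_zero])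
  let G : M P n lam →ₗ[k] k := (wordBasis P n).constr k g ∘ₗ incl P n lam
  have hG : ∀ s (hs : weight s = lam), G (word P s hs) = g s := fun s hs =>
    (wordBasis P n).constr_basis k g s
  have key : ∀ i : Fin n, 0 < i.val → ∀ s (hs : weight s = lam), s (prev i) = 1 → s i = 0 →
      θ i (word P s hs) = G (Blob.U P i • word P s hs) := by
    intro i hi s hs h1 h0
    have := hg i hi (swapW i s) (by rw [swapW_left, h0]) (by rw [swapW_right, h1])
    rw [swapW_swapW, dif_pos hs] at this
    rw [U_word_one_zero P i hi s hs h1 h0, map_sub, map_smul, hG, hG, this, smul_eq_mul]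
    ring
  -- Since [2] ≠ 0, `θ i` is determined by its composite with U_i. This settles the words reading
  -- v₁v₂ or two equal letters at `i`, which the potential does not address directly.
  have hθ : ∀ i : Fin n, 0 < i.val → ∀ v, θ i v = -(gaussInt P.q 2)⁻¹ * θ i (Blob.U P i • v) := by
    intro i hi v
    rw [hsq i hi]
    field_simp
  refine ⟨G, fun i hi v => ?_⟩
  suffices h : θ i = G ∘ₗ (Module.toModuleEnd k (S := Blob P n) (M P n lam) (Blob.U P i)) from
    LinearMap.congr_fun h v
  refine perm_ext P fun s hs => ?_
  change θ i (word P s hs) = G (Blob.U P i • word P s hs)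
  rcases Fin2_cases (s (prev i)) with h1 | h1 <;> rcases Fin2_cases (s i) with h2 | h2
  · rw [hθ i hi, U_word_same P i hi s hs (by rw [h1, h2]), map_zero, map_zero, mul_zero]
  · have hz := key i hi (swapW i s) ((weight_swapW i s).trans hs) (by rw [swapW_left, h2])
      (by rw [swapW_right, h1])
    rw [hθ i hi, U_word_zero_one P i hi s hs h1 h2, map_smul (θ i) (-P.q⁻¹),
      map_smul G (-P.q⁻¹), ← hz, hsq i hi, smul_eq_mul,
      smul_eq_mul]
    field_simp
  · exact key i hi s hs h1 h2
  · rw [hθ i hi, U_word_same P i hi s hs (by rw [h1, h2]), map_zero, map_zero, mul_zero]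

end Perm

end ATY

end

/-! ## Surjectivity of the adjointness map -/

noncomputable section

namespace ATY

variable {k : Type*} [Field k] (P : BlobParams k) {n : ℕ}

/-- The obstruction for `permFun` to be an eigenvector of `U_0`. -/
def obstruction (n₂ : ℕ) : k := P.lam₁ * (P.q⁻¹ ^ 2) ^ n₂ - P.lam₂

/-- The vanishing means q^(2(m − n₂)) = 1, and the factor 2 can be dropped because l is odd. -/
lemma obstruction_eq_zero_iff {l : ℕ} (hl : Odd l) (hq : IsPrimitiveRoot P.q l) (n₂ : ℕ) :
    obstruction P n₂ = 0 ↔ (n₂ : ℤ) ≡ P.m [ZMOD l] := by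
  have h0 := P.q_ne_zero
  have hd := P.q_sub_ne_zero
  have h1 : obstruction P n₂ = 0 ↔ P.q ^ (2 * (P.m - n₂)) = 1 := by
    have e : P.q ^ (2 * (P.m - n₂)) = P.q ^ P.m * (P.q⁻¹ ^ 2) ^ n₂ * P.q ^ P.m := by
      rw [← pow_mul, inv_pow, ← zpow_natCast P.q (2 * n₂), ← zpow_neg, ← zpow_add₀ h0,
        ← zpow_add₀ h0]
      congr 1
      push_cast
      ring
    rw [e, obstruction, BlobParams.lam₁, BlobParams.lam₂, sub_eq_zero, div_mul_eq_mul_div,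
      div_left_inj' hd, zpow_neg, ← mul_eq_one_iff_eq_inv₀ (zpow_ne_zero _ h0)]
  rw [h1, hq.zpow_eq_one_iff_dvd, Int.modEq_iff_dvd]
  refine ⟨fun h => ?_, fun h => Dvd.dvd.mul_left h 2⟩
  refine IsCoprime.dvd_of_dvd_mul_left ?_ h
  have := Nat.isCoprime_iff_coprime.mpr (Nat.coprime_two_right.mpr hl)
  exact_mod_cast this

lemma lam_sub_ne_zero : P.lam₂ - P.lam₁ ≠ 0 := sub_ne_zero.mpr P.lam_ne.symm

section

variable [NeZero n] {n₁ n₂ : ℕ}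

/-- `permFun₁` detects U_1: on a word beginning with v₁v₂ only the term −q⁻¹ times the word itself
survives. This provides vectors in the kernel of `permFun` on which `permFun₁` is nonzero. -/
lemma exists_permFun₁_U_ne_zero (hn : n₁ + n₂ = n) (h1 : 0 < n₁) (h2 : 0 < n₂) :
    ∃ (i : Fin n) (v : M P n ((n₁ : ℤ) - n₂)), 0 < i.val ∧
      permFun₁ P n _ (Blob.U P i • v) ≠ 0 := by
  obtain ⟨s, hs, hs0, hs1⟩ := exists_word hn h1 h2
  have hn2 : 1 < n := by omega
  have h0 : prev (⟨1, hn2⟩ : Fin n) = 0 := Fin.ext (by simp [prev])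
  have hi1 := hs1 ⟨1, hn2⟩ rfl
  have hsw : swapW (⟨1, hn2⟩ : Fin n) s 0 = 1 := by
    rw [← h0, swapW_left, hi1]
  refine ⟨⟨1, hn2⟩, word P s hs, one_pos, ?_⟩
  rw [permFun₁, LinearMap.comp_apply, incl_U_pos P _ one_pos, incl_word,
    E_zero_one P _ s (by rw [h0, hs0]) hi1, map_sub, map_smul, symFun₁_vec, symFun₁_vec, if_pos hs0,
    if_neg (by rw [hsw]; decide), zero_sub, smul_eq_mul, neg_ne_zero]
  exact mul_ne_zero (inv_ne_zero P.q_ne_zero) (pow_ne_zero _ P.q_ne_zero)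

lemma permFun_ne_zero (hn : n₁ + n₂ = n) (h1 : 0 < n₁) (h2 : 0 < n₂) :
    ∃ v : M P n ((n₁ : ℤ) - n₂), permFun P n _ v ≠ 0 := by
  obtain ⟨s, hs, -, -⟩ := exists_word hn h1 h2
  exact ⟨word P s hs, by rw [permFun_word]; exact pow_ne_zero _ P.q_ne_zero⟩

/-- The sum of the `U_i M`, `i ≥ 1`, is the kernel of `permFun`. -/
lemma mem_of_permFun_eq_zero (hn : n₁ + n₂ = n) (h1 : 0 < n₁) (h2 : 0 < n₂)
    (Q : Submodule k (M P n ((n₁ : ℤ) - n₂)))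
    (hQ : ∀ i : Fin n, 0 < i.val → ∀ v, Blob.U P i • v ∈ Q) (v : M P n ((n₁ : ℤ) - n₂))
    (hv : permFun P n _ v = 0) : v ∈ Q := by
  -- Duality: a vector outside `Q` is separated from it by a functional, which must be a multiple of
  -- `permFun`.
  by_contra hvQ
  obtain ⟨f, hf, hfQ⟩ := Submodule.exists_le_ker_of_notMem hvQ
  obtain ⟨a, ha⟩ := eq_smul_permFun P hn h1 h2 f fun i hi w => hfQ (hQ i hi w)
  exact hf (by rw [ha, hv, mul_zero])

/-- A submodule containing e M contains the hyperplane ker `permFun`. Applying U_0 to a vector U_i v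
with `permFun₁` nonzero leaves that hyperplane, because the obstruction is nonzero. -/
lemma perm_generatedByE (hn : n₁ + n₂ = n) (h1 : 0 < n₁) (h2 : 0 < n₂)
    (hob : obstruction P n₂ ≠ 0) : Blob.GeneratedByE P n (M P n ((n₁ : ℤ) - n₂)) := by
  intro S hS
  have hU := Blob.U_smul_mem P S hS
  have hmem := mem_of_permFun_eq_zero P hn h1 h2 (S.restrictScalars k) hU
  obtain ⟨i, v, hi, hv⟩ := exists_permFun₁_U_ne_zero P hn h1 h2
  have hw := S.smul_mem (Blob.U P (0 : Fin n)) (hU i hi v)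
  have hne : permFun P n _ (Blob.U P (0 : Fin n) • Blob.U P i • v) ≠ 0 := by
    rw [permFun_U_zero P hn, permFun_U P i hi, mul_zero, add_zero]
    exact mul_ne_zero hob hv
  set w := Blob.U P (0 : Fin n) • Blob.U P i • v
  refine eq_top_iff.mpr fun x _ => ?_
  have h3 : x - (permFun P n _ x / permFun P n _ w) • w ∈ S.restrictScalars k := hmem _ (by
    rw [map_sub, map_smul, smul_eq_mul, div_mul_cancel₀ _ hne, sub_self])
  have h4 := (S.restrictScalars k).add_mem h3
    ((S.restrictScalars k).smul_mem (permFun P n _ x / permFun P n _ w) hw)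
  rwa [sub_add_cancel] at h4

/-- When the obstruction vanishes, ker `permFun` is stable under U_0 as well, so it is a proper
submodule containing e M. -/
lemma perm_not_generatedByE (hn : n₁ + n₂ = n) (h1 : 0 < n₁) (h2 : 0 < n₂)
    (hob : obstruction P n₂ = 0) : ¬ Blob.GeneratedByE P n (M P n ((n₁ : ℤ) - n₂)) := by
  intro h
  have hU : ∀ i : Fin n, ∀ d ∈ LinearMap.ker (permFun P n ((n₁ : ℤ) - n₂)),
      Blob.U P i • d ∈ LinearMap.ker (permFun P n ((n₁ : ℤ) - n₂)) := by
    intro i d hd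
    rw [LinearMap.mem_ker] at hd ⊢
    rcases Nat.eq_zero_or_pos i.val with hi | hi
    · have : i = 0 := Fin.ext (by rw [hi, Fin.val_zero])
      rw [this, permFun_U_zero P hn, hd, mul_zero, add_zero]
      exact mul_eq_zero_of_left hob _
    · exact permFun_U P i hi d
  have hS := h (Blob.submoduleOfU P _ hU) fun d => by
    rw [Blob.mem_submoduleOfU, LinearMap.mem_ker, Blob.e_eq, mul_smul, algebraMap_smul, map_smul, Blob.Ulast,
      permFun_U P _ (by simp; omega), smul_zero]
  obtain ⟨v, hv⟩ := permFun_ne_zero P hn h1 h2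
  exact hv (hS ▸ Submodule.mem_top : v ∈ Blob.submoduleOfU P _ hU)

end

end ATY

/-! ### The image of the adjointness map -/

section

variable {k : Type*} [Field k] (P : BlobParams k) {n : ℕ} [NeZero n] {lam : ℤ}

lemma GFM_generatedByE (hn : 2 ≤ n) : Blob.GeneratedByE P n (GFM P n hn lam) :=
  Blob.GlobG.generatedByE P hn _

lemma phi_surjective_iff (hn : 2 ≤ n) :
    Function.Surjective (phi P n hn lam) ↔ Blob.GeneratedByE P n (ATY.M P n lam) := by
  refine ⟨fun h => (GFM_generatedByE P hn).of_surjective P _ h, fun h => ?_⟩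
  rw [← LinearMap.range_eq_top]
  exact h _ fun v => ⟨_, adjMap_eSpan (Blob.e_idem P n hn) v⟩

end

end

noncomputable section

/-! ## An extension of the tensor space -/

namespace ATY

variable {k : Type*} [Field k] (P : BlobParams k) {n : ℕ}

/-- The space underlying an extension of the tensor space by a one-dimensional module. -/
abbrev ExtSpace {k : Type*} [Field k] (P : BlobParams k) (n : ℕ) : Type _ := TensorSpace P n × k

variable [NeZero n]

/-- The operator by which `U_i` acts on the extension. -/
def extU (i : Fin n) : Module.End k (ExtSpace P n) :=
  if i = 0 then
    LinearMap.prod (E₀ P ∘ₗ LinearMap.fst k _ _)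
      (symFun₁ P n ∘ₗ LinearMap.fst k _ _ + (P.lam₂ - P.lam₁) • LinearMap.snd k _ _)
  else LinearMap.prod (E P i ∘ₗ LinearMap.fst k _ _) 0

lemma extU_zero (i : Fin n) (hi : i.val = 0) (x : ExtSpace P n) :
    extU P i x = (E₀ P x.1, symFun₁ P n x.1 + (P.lam₂ - P.lam₁) * x.2) := by
  have : i = 0 := Fin.ext (by simpa using hi)
  rw [extU, if_pos this]
  rfl

lemma extU_pos (i : Fin n) (hi : 0 < i.val) (x : ExtSpace P n) :
    extU P i x = (E P i x.1, (0 : k)) := by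
  have : i ≠ 0 := fun e => by subst e; simp at hi
  rw [extU, if_neg this]
  rfl

lemma E₀_E (i : Fin n) (hi : 2 ≤ i.val) : E₀ P * E P i = E P i * E₀ P := by
  have h := opU_rel P (BlobRel.far (P := P) 0 i (by rwa [Fin.val_zero, zero_add]))
  rwa [map_mul, map_mul, FreeAlgebra.lift_ι_apply, FreeAlgebra.lift_ι_apply, opU_zero P 0 rfl,
    opU_pos P i (by omega)] at h

lemma E_far (i j : Fin n) (hi : 0 < i.val) (h : i.val + 2 ≤ j.val) :
    E P i * E P j = E P j * E P i := by
  have h := opU_rel P (BlobRel.far (P := P) i j h)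
  rwa [map_mul, map_mul, FreeAlgebra.lift_ι_apply, FreeAlgebra.lift_ι_apply, opU_pos P i hi,
    opU_pos P j (by omega)] at h

/-- The relations reduce to those on the tensor space because `symFun₁` vanishes on the images of
U_0 and of U_j, j ≥ 2, while the U_i with i ≥ 1 annihilate the second coordinate. The relation for
U_0² needs U_0 to act on that coordinate by λ₂ − λ₁ = −[m], which is the case. -/
lemma extU_rel ⦃x y : FreeAlgebra k (Fin n)⦄ (h : BlobRel P n x y) :
    FreeAlgebra.lift k (extU P) x = FreeAlgebra.lift k (extU P) y := by
  cases h with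
  | sq i hi =>
    simp only [map_mul, map_smul, FreeAlgebra.lift_ι_apply]
    refine LinearMap.ext fun v => ?_
    rw [Module.End.mul_apply, LinearMap.smul_apply, extU_pos P i hi, extU_pos P i hi, Prod.smul_mk,
      smul_zero, ← Module.End.mul_apply, E_sq P i hi, LinearMap.smul_apply]
  | sq_zero i hi =>
    simp only [map_mul, map_smul, FreeAlgebra.lift_ι_apply]
    refine LinearMap.ext fun v => ?_
    rw [Module.End.mul_apply, LinearMap.smul_apply, extU_zero P i hi, extU_zero P i hi,
      Prod.smul_mk, ← Module.End.mul_apply, E₀_sq P, LinearMap.smul_apply, symFun₁_E₀, zero_add,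
      P.lam_sub, smul_eq_mul]
  | one_zero_one i j hi hj =>
    have hi' : 0 < i.val := by omega
    simp only [map_mul, map_smul, FreeAlgebra.lift_ι_apply]
    refine LinearMap.ext fun v => ?_
    rw [Module.End.mul_apply, Module.End.mul_apply, LinearMap.smul_apply, extU_pos P i hi',
      extU_pos P i hi', extU_zero P j hj, Prod.smul_mk, smul_zero, ← Module.End.mul_apply,
      ← Module.End.mul_apply, E_E₀_E P i hi, LinearMap.smul_apply]
  | adjacent i j hi hj h =>
    simp only [map_mul, FreeAlgebra.lift_ι_apply]
    refine LinearMap.ext fun v => ?_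
    rw [Module.End.mul_apply, Module.End.mul_apply, extU_pos P i hi,
      extU_pos P i hi, extU_pos P j hj, ← Module.End.mul_apply, ← Module.End.mul_apply]
    rcases h with h | h
    · rw [E_left P i j hi h.symm]
    · rw [E_right P j i hj h.symm]
  | far i j h =>
    have hj : 0 < j.val := by omega
    simp only [map_mul, FreeAlgebra.lift_ι_apply]
    refine LinearMap.ext fun v => ?_
    rcases Nat.eq_zero_or_pos i.val with hi | hi
    · rw [Module.End.mul_apply, Module.End.mul_apply, extU_pos P j hj, extU_pos P j hj,
        extU_zero P i hi, extU_zero P i hi, mul_zero, add_zero, symFun₁_E P j (by omega),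
        ← Module.End.mul_apply, ← Module.End.mul_apply, E₀_E P j (by omega)]
    · rw [Module.End.mul_apply, Module.End.mul_apply, extU_pos P j hj, extU_pos P j hj,
        extU_pos P i hi, extU_pos P i hi, ← Module.End.mul_apply, ← Module.End.mul_apply,
        E_far P i j hi h]

/-- The extension as a representation of the blob algebra. -/
def extRep (n : ℕ) [NeZero n] : Blob P n →ₐ[k] Module.End k (ExtSpace P n) :=
  Blob.lift P (FreeAlgebra.lift k (extU P)) (extU_rel P)

lemma extRep_U (i : Fin n) : extRep P n (Blob.U P i) = extU P i := by
  rw [extRep, Blob.U, Blob.lift_mk, FreeAlgebra.lift_ι_apply]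

instance : Module (Blob P n) (ExtSpace P n) :=
  Module.compHom (ExtSpace P n) (extRep P n).toRingHom

lemma ext_smul_def (b : Blob P n) (v : ExtSpace P n) : b • v = extRep P n b v := rfl

instance : IsScalarTower k (Blob P n) (ExtSpace P n) where
  smul_assoc c b v := by simp [ext_smul_def]

lemma ext_U_zero_smul (i : Fin n) (hi : i.val = 0) (x : ExtSpace P n) :
    Blob.U P i • x = ((Blob.U P i • x.1, symFun₁ P n x.1 + (P.lam₂ - P.lam₁) * x.2) :
      ExtSpace P n) := by
  rw [ext_smul_def, extRep_U, smul_def, rep_U, opU_zero P i hi]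
  exact extU_zero P i hi x

lemma ext_U_pos_smul (i : Fin n) (hi : 0 < i.val) (x : ExtSpace P n) :
    Blob.U P i • x = ((Blob.U P i • x.1, 0) : ExtSpace P n) := by
  rw [ext_smul_def, extRep_U, smul_def, rep_U, opU_pos P i hi]
  exact extU_pos P i hi x

lemma ext_smul_fst (b : Blob P n) (x : ExtSpace P n) : (b • x).1 = b • x.1 := by
  obtain ⟨y, rfl⟩ := Blob.mk_surjective P n b
  induction y using FreeAlgebra.induction generalizing x with
  | grade0 c => rw [AlgHom.commutes, algebraMap_smul, algebraMap_smul]; rfl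
  | grade1 i =>
    change (Blob.U P i • x).1 = Blob.U P i • x.1
    rcases Nat.eq_zero_or_pos i.val with hi | hi
    · rw [ext_U_zero_smul P i hi]
    · rw [ext_U_pos_smul P i hi]
  | mul y z hy hz => rw [map_mul, mul_smul, mul_smul, hy, hz]
  | add y z hy hz => rw [map_add, add_smul, add_smul, ← hy, ← hz]; rfl

lemma ext_e_smul (hn : 2 ≤ n) (x : ExtSpace P n) :
    Blob.e P n • x = ((Blob.e P n • x.1, 0) : ExtSpace P n) := by
  rw [Blob.e_eq, mul_smul, mul_smul, algebraMap_smul, algebraMap_smul, Blob.Ulast,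
    ext_U_pos_smul P _ (by simp; omega)]
  exact Prod.ext rfl (mul_zero _)

/-- The pairs `(v, 0)` with `v` in `e M_n(λ)`. -/
def locToExt (hn : 2 ≤ n) (lam : ℤ) :
    LocF (Blob.e_idem P n hn) (M P n lam) →+ ExtSpace P n :=
  (AddMonoidHom.inl (TensorSpace P n) k).comp
    ((M P n lam).subtype.toAddMonoidHom.comp (LocF (Blob.e_idem P n hn) (M P n lam)).subtype)

lemma locToExt_apply (hn : 2 ≤ n) (lam : ℤ) (y : LocF (Blob.e_idem P n hn) (M P n lam)) :
    locToExt P hn lam y = (((y : M P n lam) : TensorSpace P n), 0) := rfl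

/-- The map y ↦ (y, 0) does not commute with U_0, but it does with e B e: such elements absorb e on
the left, and e kills the second coordinate. -/
lemma locToExt_smul (hn : 2 ≤ n) (lam : ℤ) (a : (Blob.e_idem P n hn).Corner)
    (y : LocF (Blob.e_idem P n hn) (M P n lam)) :
    locToExt P hn lam (a • y) = a.1 • locToExt P hn lam y := by
  rw [← corner_left _ a, mul_smul, ext_e_smul P hn, ext_smul_fst, ← mul_smul, corner_left _ a]
  rfl

/-- The map `B e ⊗ e M_n(λ) → Y`, `x ⊗ y ↦ x (y, 0)`, to the extension `Y`. -/
def tensorToExt (hn : 2 ≤ n) (lam : ℤ) :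
    Ideal.span {Blob.e P n} ⊗[ℤ] LocF (Blob.e_idem P n hn) (M P n lam) →ₗ[Blob P n]
      ExtSpace P n :=
  TensorProduct.AlgebraTensorModule.lift
    { toFun := fun x =>
        { toFun := fun y => (x : Blob P n) • locToExt P hn lam y
          map_add' := fun y z => by rw [map_add, smul_add]
          map_smul' := fun c y => by rw [map_zsmul, RingHom.id_apply, smul_comm] }
      map_add' := fun x y => LinearMap.ext fun z => add_smul (x : Blob P n) (y : Blob P n) _
      map_smul' := fun b x => LinearMap.ext fun z => mul_smul b (x : Blob P n) _ }

lemma tensorToExt_tmul (hn : 2 ≤ n) (lam : ℤ) (x : Ideal.span {Blob.e P n})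
    (y : LocF (Blob.e_idem P n hn) (M P n lam)) :
    tensorToExt P hn lam (x ⊗ₜ[ℤ] y) = (x : Blob P n) • locToExt P hn lam y := rfl

/-- The map `G (F M_n(λ)) → Y`, `x ⊗ y ↦ x (y, 0)`, to the extension `Y`. -/
def toExt (hn : 2 ≤ n) (lam : ℤ) : GFM P n hn lam →ₗ[Blob P n] ExtSpace P n :=
  (balanced (Blob.e_idem P n hn) (LocF (Blob.e_idem P n hn) (M P n lam))).liftQ
    (tensorToExt P hn lam) <| Submodule.span_le.mpr <| by
      rintro _ ⟨x, a, y, rfl⟩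
      rw [SetLike.mem_coe, LinearMap.mem_ker, map_sub, tensorToExt_tmul, tensorToExt_tmul,
        locToExt_smul, ← mul_smul]
      exact sub_self _

lemma toExt_mk (hn : 2 ≤ n) (lam : ℤ) (x : Ideal.span {Blob.e P n})
    (y : LocF (Blob.e_idem P n hn) (M P n lam)) :
    toExt P hn lam (Submodule.Quotient.mk (x ⊗ₜ[ℤ] y)) = (x : Blob P n) • locToExt P hn lam y := rfl

lemma toExt_fst (hn : 2 ≤ n) (lam : ℤ) (z : GFM P n hn lam) :
    (toExt P hn lam z).1 = (phi P n hn lam z : TensorSpace P n) := by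
  obtain ⟨t, rfl⟩ := Submodule.Quotient.mk_surjective _ z
  induction t using TensorProduct.induction_on with
  | zero => rw [Submodule.Quotient.mk_zero, map_zero, map_zero]; rfl
  | add x y hx hy =>
    rw [Submodule.Quotient.mk_add, map_add, map_add, Prod.fst_add, hx, hy]
    rfl
  | tmul x y =>
    rw [toExt_mk, ext_smul_fst, phi, adjMap_mk]
    rfl

/-- The range of `toExt` contains (w, 0) for every w in ker `permFun`. Choose w = U_i v there with
`permFun₁` nonzero. The range contains U_0 (w, 0), whose second coordinate is `permFun₁` of w, and
also (U_0 w, 0), because U_0 preserves ker `permFun`. The difference has first coordinate 0, so any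
preimage of it is a nonzero element of the kernel of φ. -/
lemma phi_not_injective (hn : 2 ≤ n) {n₁ n₂ : ℕ} (hn' : n₁ + n₂ = n) (h1 : 0 < n₁) (h2 : 0 < n₂)
    (hob : obstruction P n₂ = 0) :
    ¬ Function.Injective (phi P n hn ((n₁ : ℤ) - n₂)) := by
  intro hinj
  set R := LinearMap.range (toExt P hn ((n₁ : ℤ) - n₂)) with hR
  let Q : Submodule k (M P n ((n₁ : ℤ) - n₂)) :=
    (R.restrictScalars k).comap (LinearMap.inl k (TensorSpace P n) k ∘ₗ incl P n _)
  have hQ : ∀ v, v ∈ Q ↔ ((incl P n _ v, 0) : ExtSpace P n) ∈ R := fun v => Iff.rfl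
  have hUQ : ∀ (i : Fin n), 0 < i.val → ∀ v, Blob.U P i • v ∈ Q := by
    refine Blob.U_smul_induction P (· ∈ Q) (fun v => ?_) (fun i j hi hij v hv => ?_)
    · rw [Blob.Ulast_eq, mul_smul, algebraMap_smul]
      refine Q.smul_mem _ ((hQ _).mpr ⟨Submodule.Quotient.mk (eSpan (Blob.e P n) ⊗ₜ[ℤ]
        LocF.mk (Blob.e_idem P n hn) v), ?_⟩)
      rw [toExt_mk]
      change Blob.e P n • locToExt P hn _ _ = _
      rw [ext_e_smul P hn, locToExt_apply]
      change ((Blob.e P n • Blob.e P n • (v : TensorSpace P n), (0 : k)) : ExtSpace P n) = _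
      rw [smul_smul, (Blob.e_idem P n hn).eq]
      rfl
    · have := R.smul_mem (Blob.U P i) ((hQ _).mp hv)
      rw [ext_U_pos_smul P i hi] at this
      exact this
  obtain ⟨i, v, hi, hv⟩ := exists_permFun₁_U_ne_zero P hn' h1 h2
  have ha := R.smul_mem (Blob.U P (0 : Fin n)) ((hQ _).mp (hUQ i hi v))
  rw [ext_U_zero_smul P 0 rfl, mul_zero, add_zero] at ha
  have hb := mem_of_permFun_eq_zero P hn' h1 h2 Q hUQ (Blob.U P (0 : Fin n) • Blob.U P i • v) (by
    rw [permFun_U_zero P hn', permFun_U P i hi, mul_zero, add_zero]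
    exact mul_eq_zero_of_left hob _)
  obtain ⟨z, hz⟩ := R.sub_mem ha ((hQ _).mp hb)
  have hz1 : phi P n hn _ z = 0 := Subtype.ext (by
    rw [← toExt_fst, hz]
    exact sub_self _)
  rw [hinj (hz1.trans (map_zero _).symm), map_zero] at hz
  have := congrArg Prod.snd hz
  exact hv ((sub_zero _).symm.trans this.symm)

end ATY

end

/-! ## Injectivity of the adjointness map -/

noncomputable section

namespace ATY

variable {k : Type*} [Field k] (P : BlobParams k) {n : ℕ} [NeZero n] {n₁ n₂ : ℕ}

/-- The cocycles on a permutation module which describe its extensions by the one-dimensional module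
on which `U_0` acts by `c` are coboundaries. -/
lemma exists_coboundary (hn : n₁ + n₂ = n) (h1 : 0 < n₁) (h2 : 0 < n₂)
    (hob : obstruction P n₂ ≠ 0) (c : k) (hc : c = 0 ∨ c = P.lam₂ - P.lam₁)
    (η : M P n ((n₁ : ℤ) - n₂) →ₗ[k] k)
    (hη : ∀ i : Fin n, 1 < i.val → ∀ v, η (Blob.U P i • v) = 0)
    (hη0 : ∀ v, η (Blob.U P (0 : Fin n) • v) = (P.lam₂ - P.lam₁ - c) * η v) :
    ∃ r : k, ∀ v, η v =
      r * (permFun P n _ (Blob.U P (0 : Fin n) • v) - c * permFun P n _ v) := by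
  have hB := lam_sub_ne_zero P
  obtain ⟨a, b, hab⟩ := eq_combination_permFun P hn h1 h2 η hη
  have hU0 : ∀ v, permFun P n _ (Blob.U P (0 : Fin n) • v) = obstruction P n₂ *
      permFun₁ P n _ v + (P.lam₂ - P.lam₁) * permFun P n _ v := permFun_U_zero P hn
  have hrel : ∀ v : M P n ((n₁ : ℤ) - n₂), b *
      (obstruction P n₂ * permFun₁ P n _ v + (P.lam₂ - P.lam₁) * permFun P n _ v) =
      (P.lam₂ - P.lam₁ - c) * (a * permFun₁ P n _ v + b * permFun P n _ v) := by
    intro v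
    have := hη0 v
    rwa [hab, hab, permFun₁_U_zero, hU0, mul_zero, zero_add] at this
  -- The coefficients of the two functionals are compared: at a vector with `permFun` zero and
  -- `permFun₁` nonzero, and then at one with `permFun` nonzero.
  have e1 : b * obstruction P n₂ = (P.lam₂ - P.lam₁ - c) * a := by
    obtain ⟨i, v, hi, hv⟩ := exists_permFun₁_U_ne_zero P hn h1 h2
    have := hrel (Blob.U P i • v)
    rw [permFun_U P i hi] at this
    exact mul_right_cancel₀ hv (by linear_combination this)
  have e2 : b * c = 0 := by
    obtain ⟨v, hv⟩ := permFun_ne_zero P hn h1 h2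
    exact mul_right_cancel₀ hv (by linear_combination hrel v - permFun₁ P n _ v * e1)
  rcases hc with rfl | rfl
  · refine ⟨b / (P.lam₂ - P.lam₁), fun v => ?_⟩
    rw [hab, hU0]
    field_simp
    linear_combination -permFun₁ P n _ v * e1
  -- This is the case that needs a nonzero obstruction: here the available coboundary is the
  -- obstruction times `permFun₁`.
  · have hb : b = 0 := (mul_eq_zero.mp e2).resolve_right hB
    refine ⟨a / obstruction P n₂, fun v => ?_⟩
    rw [hab, hU0, hb]
    field_simp
    ring

/-- From a nonzero z in ker φ one builds a functional on D that is nonzero at z, vanishes on U_i D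
for i ≥ 1 and is an eigenvector of U_0. Its kernel is then a submodule containing e D, hence all of
D, a contradiction. The corrections leading to it are functionals pulled back from M, so they do not
change the value at z. -/
lemma injective_of_surjective (hn2 : 2 ≤ n) (hn : n₁ + n₂ = n) (h1 : 0 < n₁) (h2 : 0 < n₂)
    (hob : obstruction P n₂ ≠ 0) {D : Type*} [AddCommGroup D] [Module k D] [Module (Blob P n) D]
    [IsScalarTower k (Blob P n) D] (hD : Blob.GeneratedByE P n D)
    (φ : D →ₗ[Blob P n] M P n ((n₁ : ℤ) - n₂)) (hφ : Function.Surjective φ)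
    (hK : ∀ z, φ z = 0 → Blob.e P n • z = 0) : Function.Injective φ := by
  let B : k := P.lam₂ - P.lam₁
  have hB : B ≠ 0 := lam_sub_ne_zero P
  have hU00 : ∀ d : D, Blob.U P (0 : Fin n) • Blob.U P (0 : Fin n) • d =
      B • Blob.U P (0 : Fin n) • d := fun d => by
    rw [← mul_smul, Blob.U_sq_zero P 0 rfl, ← P.lam_sub, smul_assoc]
  -- The kernel is itself a module killed by e, so the zero submodule contains its images under the
  -- U_i, i ≥ 1.
  have hKU : ∀ i : Fin n, 0 < i.val → ∀ z, φ z = 0 → Blob.U P i • z = 0 := by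
    intro i hi z hz
    have := Blob.U_smul_mem P (⊥ : Submodule (Blob P n) (LinearMap.ker φ))
      (fun d => (Submodule.mem_bot _).mpr (Subtype.ext (hK d d.2))) i hi ⟨z, hz⟩
    exact congrArg Subtype.val ((Submodule.mem_bot _).mp this)
  rw [← LinearMap.ker_eq_bot, LinearMap.ker_eq_bot']
  intro z hz
  by_contra hz0
  let π : D →ₗ[k] M P n ((n₁ : ℤ) - n₂) := φ.restrictScalars k
  let u : Fin n → D →ₗ[k] D := fun i => Module.toModuleEnd k D (Blob.U P i)
  -- A merely linear section; it serves to write functionals that vanish on ker φ as functionals on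
  -- M.
  obtain ⟨σ, hσ⟩ := π.exists_rightInverse_of_surjective (LinearMap.range_eq_top.mpr hφ)
  have hσ' : ∀ d, φ (σ (φ d) - d) = 0 := fun d => by
    rw [map_sub, sub_eq_zero]
    exact LinearMap.congr_fun hσ (φ d)
  -- descent of functionals along `φ`
  have descend : ∀ f : D →ₗ[k] k, (∀ z, φ z = 0 → f z = 0) → ∀ d, (f ∘ₗ σ) (φ d) = f d := by
    intro f hf d
    have := hf _ (hσ' d)
    rwa [map_sub, sub_eq_zero] at this
  obtain ⟨c, hc, l, hlz, hl⟩ : ∃ c : k, (c = 0 ∨ c = B) ∧ ∃ l : D →ₗ[k] k, l z ≠ 0 ∧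
      ∀ d, l (Blob.U P (0 : Fin n) • d) = c * l d := by
    obtain ⟨f, hf, -⟩ := Submodule.exists_le_ker_of_notMem
      (fun h => hz0 ((Submodule.mem_bot k).mp h) : z ∉ (⊥ : Submodule k D))
    -- U_0 (U_0 − B) = 0, so both f ∘ U_0 and f ∘ U_0 − B f are eigenvectors, for B and for 0. At
    -- least one of them is nonzero at z.
    by_cases h : f (Blob.U P (0 : Fin n) • z) = 0
    · refine ⟨0, Or.inl rfl, f ∘ₗ u 0 - B • f, ?_, fun d => ?_⟩
      · change f (Blob.U P (0 : Fin n) • z) - B * f z ≠ 0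
        rw [h, zero_sub, neg_ne_zero]
        exact mul_ne_zero hB hf
      · change f (Blob.U P (0 : Fin n) • Blob.U P (0 : Fin n) • d) -
          B * f (Blob.U P (0 : Fin n) • d) = 0 * _
        rw [hU00, map_smul, smul_eq_mul, sub_self, zero_mul]
    · refine ⟨B, Or.inr rfl, f ∘ₗ u 0, h, fun d => ?_⟩
      change f (Blob.U P (0 : Fin n) • Blob.U P (0 : Fin n) • d) = B * f (Blob.U P (0 : Fin n) • d)
      rw [hU00, map_smul, smul_eq_mul]
  -- `l` is corrected so that it vanishes on all `U_i D`, `i ≥ 1`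
  have hθ : ∀ i : Fin n, 0 < i.val → ∀ d, ((l ∘ₗ u i) ∘ₗ σ) (φ d) = l (Blob.U P i • d) :=
    fun i hi d => descend (l ∘ₗ u i) (fun z hz => by
      change l (Blob.U P i • z) = 0
      rw [hKU i hi z hz, map_zero]) d
  obtain ⟨g, hg⟩ := exists_primitive P (fun i => (l ∘ₗ u i) ∘ₗ σ)
    (fun i hi v => by
      obtain ⟨d, rfl⟩ := hφ v
      rw [← map_smul φ, hθ i hi, hθ i hi, ← mul_smul, Blob.U_sq P i hi, smul_assoc, map_smul,
        smul_eq_mul])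
    (fun i j hi hij v => by
      obtain ⟨d, rfl⟩ := hφ v
      rw [← map_smul φ, ← map_smul φ, hθ i hi, hθ j (by omega), ← mul_smul, ← mul_smul,
        Blob.U_far P i j hij])
  obtain ⟨l', hl'⟩ : ∃ l' : D →ₗ[k] k, ∀ d, l' d = l d - g (φ d) := ⟨l - g ∘ₗ π, fun d => rfl⟩
  have hl'U : ∀ i : Fin n, 0 < i.val → ∀ d, l' (Blob.U P i • d) = 0 := by
    intro i hi d
    rw [hl', map_smul φ, ← hg i hi, hθ i hi, sub_self]
  -- and then so that it is an eigenvector of `U_0`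
  have hη : ∀ d, ((l' ∘ₗ u 0 - c • l') ∘ₗ σ) (φ d) = l' (Blob.U P (0 : Fin n) • d) - c * l' d :=
    descend (l' ∘ₗ u 0 - c • l') fun z hz => by
      change l' (Blob.U P (0 : Fin n) • z) - c * l' z = 0
      rw [hl', hl', map_smul φ, hz, smul_zero, map_zero, hl]
      ring
  have hcB : (B - c) * c = 0 := by
    rcases hc with rfl | rfl <;> simp
  obtain ⟨r, hr⟩ := exists_coboundary P hn h1 h2 hob c hc ((l' ∘ₗ u 0 - c • l') ∘ₗ σ)
    (fun i hi v => by
      obtain ⟨d, rfl⟩ := hφ v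
      rw [← map_smul φ, hη, ← mul_smul, Blob.U_far P 0 i (by rw [Fin.val_zero]; omega), mul_smul,
        hl'U i (by omega), hl'U i (by omega), mul_zero, sub_zero])
    (fun v => by
      obtain ⟨d, rfl⟩ := hφ v
      rw [← map_smul φ, hη, hη, hU00, map_smul, smul_eq_mul]
      linear_combination l' d * hcB)
  obtain ⟨l'', hl''⟩ : ∃ l'' : D →ₗ[k] k, ∀ d, l'' d = l' d - r * permFun P n _ (φ d) :=
    ⟨l' - r • permFun P n _ ∘ₗ π, fun d => rfl⟩
  have hl''U : ∀ i : Fin n, 0 < i.val → ∀ d, l'' (Blob.U P i • d) = 0 := by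
    intro i hi d
    rw [hl'', hl'U i hi, map_smul φ, permFun_U P i hi, mul_zero, sub_zero]
  have hl''0 : ∀ d, l'' (Blob.U P (0 : Fin n) • d) = c * l'' d := by
    intro d
    have := hr (φ d)
    rw [hη] at this
    rw [hl'', hl'', map_smul φ]
    linear_combination this
  have hstable : ∀ i : Fin n, ∀ d ∈ LinearMap.ker l'', Blob.U P i • d ∈ LinearMap.ker l'' := by
    intro i d hd
    rw [LinearMap.mem_ker] at hd ⊢
    rcases Nat.eq_zero_or_pos i.val with hi | hi
    · have : i = 0 := Fin.ext (by rw [hi, Fin.val_zero])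
      rw [this, hl''0, hd, mul_zero]
    · exact hl''U i hi d
  have htop := hD (Blob.submoduleOfU P _ hstable) fun d => by
    rw [Blob.mem_submoduleOfU, LinearMap.mem_ker, Blob.e_eq, mul_smul, algebraMap_smul, map_smul,
      Blob.Ulast, hl''U _ (by simp; omega), smul_zero]
  have hmem : l'' z = 0 := (htop ▸ Submodule.mem_top : z ∈ Blob.submoduleOfU P _ hstable)
  rw [hl'', hl', hz, map_zero, map_zero, mul_zero, sub_zero, sub_zero] at hmem
  exact hlz hmem

end ATY

/-! ### The criteria, the excluded isomorphisms, and roots of unity of odd order -/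

section

variable {k : Type*} [Field k] (P : BlobParams k) {n : ℕ} [NeZero n] {n₁ n₂ : ℕ}

lemma phi_surjective_iff_obstruction (hn2 : 2 ≤ n) (hn : n₁ + n₂ = n) (h1 : 0 < n₁)
    (h2 : 0 < n₂) :
    Function.Surjective (phi P n hn2 ((n₁ : ℤ) - n₂)) ↔ ATY.obstruction P n₂ ≠ 0 :=
  (phi_surjective_iff P hn2).trans ⟨fun h hob => ATY.perm_not_generatedByE P hn h1 h2 hob h,
    ATY.perm_generatedByE P hn h1 h2⟩

lemma phi_injective_iff_obstruction (hn2 : 2 ≤ n) (hn : n₁ + n₂ = n) (h1 : 0 < n₁)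
    (h2 : 0 < n₂) :
    Function.Injective (phi P n hn2 ((n₁ : ℤ) - n₂)) ↔ ATY.obstruction P n₂ ≠ 0 :=
  ⟨fun h hob => ATY.phi_not_injective P hn2 hn h1 h2 hob h, fun hob =>
    ATY.injective_of_surjective P hn2 hn h1 h2 hob (GFM_generatedByE P hn2) _
      ((phi_surjective_iff_obstruction P hn2 hn h1 h2).mpr hob)
      fun z hz => GlobG.e_smul_eq_zero (Blob.e_idem P n hn2) z hz⟩

lemma isEmpty_GFM_equiv (hn2 : 2 ≤ n) (hn : n₁ + n₂ = n) (h1 : 0 < n₁) (h2 : 0 < n₂)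
    (hob : ATY.obstruction P n₂ = 0) :
    IsEmpty (GFM P n hn2 ((n₁ : ℤ) - n₂) ≃ₗ[Blob P n] ATY.M P n ((n₁ : ℤ) - n₂)) :=
  ⟨fun f => ATY.perm_not_generatedByE P hn h1 h2 hob
    ((GFM_generatedByE P hn2).of_surjective P f.toLinearMap f.surjective)⟩

lemma isEmpty_standardModule_equiv (hn2 : 2 ≤ n) (hn : n₁ + n₂ = n) (h1 : 0 < n₁) (h2 : 0 < n₂)
    (hob : ATY.obstruction P n₂ = 0) :
    IsEmpty (ATY.M P n ((n₁ : ℤ) - n₂) ≃ₗ[Blob P n] StandardModule P n ((n₁ : ℤ) - n₂)) :=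
  ⟨fun f => ATY.perm_not_generatedByE P hn h1 h2 hob
    ((Blob.StandardModule.generatedByE P hn2 _ (by omega)).of_surjective P f.symm.toLinearMap
      f.symm.surjective)⟩

/-- Over an algebraically closed field, there is a primitive root of unity of order `3` or `5`. -/
lemma exists_primitiveRoot (k : Type*) [Field k] [IsAlgClosed k] :
    ∃ (l : ℕ) (q : k), Odd l ∧ 3 ≤ l ∧ IsPrimitiveRoot q l := by
  have key : ∀ l : ℕ, (l : k) ≠ 0 → ∃ q : k, IsPrimitiveRoot q l := fun l hl => by
    have : NeZero (l : k) := ⟨hl⟩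
    exact HasEnoughRootsOfUnity.exists_primitiveRoot k l
  by_cases h3 : ((3 : ℕ) : k) = 0
  · have h5 : ((5 : ℕ) : k) ≠ 0 := by
      intro h5
      push_cast at h3 h5
      exact one_ne_zero (α := k) (by linear_combination 2 * h3 - h5)
    obtain ⟨q, hq⟩ := key 5 h5
    exact ⟨5, q, by decide, by norm_num, hq⟩
  · obtain ⟨q, hq⟩ := key 3 h3
    exact ⟨3, q, by decide, le_rfl, hq⟩

end

end

theorem mainTheorem2 {k : Type*} [Field k] [IsAlgClosed k] (n : ℕ) [NeZero n] (hn : 3 ≤ n) :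
    (∀ (P : BlobParams k) (l : ℕ), Odd l → IsPrimitiveRoot P.q l →
      ∀ (n₁ n₂ : ℕ) (lam : ℤ), n₁ + n₂ = n → lam = (n₁ : ℤ) - (n₂ : ℤ) →
        lam ≠ (n : ℤ) → lam ≠ -(n : ℤ) →
        (Function.Surjective (phi P n (le_of_lt hn) lam) ↔ ¬ (n₂ : ℤ) ≡ P.m [ZMOD l]) ∧
        (Function.Injective (phi P n (le_of_lt hn) lam) ↔ ¬ (n₂ : ℤ) ≡ P.m [ZMOD l]) ∧
        ((∃ f : GFM P n (le_of_lt hn) lam ≃ₗ[Blob P n] ATY.M P n lam,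
            f.toLinearMap = phi P n (le_of_lt hn) lam) ↔ ¬ (n₂ : ℤ) ≡ P.m [ZMOD l]) ∧
        ((n₂ : ℤ) ≡ P.m [ZMOD l] →
          IsEmpty (GFM P n (le_of_lt hn) lam ≃ₗ[Blob P n] ATY.M P n lam) ∧
          IsEmpty (ATY.M P n lam ≃ₗ[Blob P n] StandardModule P n lam))) ∧
    (∃ (P : BlobParams k) (l n₁ n₂ : ℕ) (lam : ℤ), Odd l ∧ IsPrimitiveRoot P.q l ∧
      n₁ + n₂ = n ∧ lam = (n₁ : ℤ) - (n₂ : ℤ) ∧ lam ≠ (n : ℤ) ∧ lam ≠ -(n : ℤ) ∧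
      (n₂ : ℤ) ≡ P.m [ZMOD l] ∧
      IsEmpty (GFM P n (le_of_lt hn) lam ≃ₗ[Blob P n] ATY.M P n lam) ∧
      IsEmpty (ATY.M P n lam ≃ₗ[Blob P n] StandardModule P n lam)) := by
  have hn2 : 2 ≤ n := le_of_lt hn
  constructor
  · rintro P l hl hq n₁ n₂ lam hsum rfl hlam hlam'
    have h1 : 0 < n₁ := by omega
    have h2 : 0 < n₂ := by omega
    have hob := ATY.obstruction_eq_zero_iff P hl hq n₂
    have hs := phi_surjective_iff_obstruction P hn2 hsum h1 h2
    have hi := phi_injective_iff_obstruction P hn2 hsum h1 h2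
    rw [Ne, hob] at hs hi
    refine ⟨hs, hi, ⟨?_, fun h => ?_⟩, fun h => ?_⟩
    · rintro ⟨f, hf⟩
      exact hs.mp (hf ▸ f.surjective)
    · exact ⟨LinearEquiv.ofBijective _ ⟨hi.mpr h, hs.mpr h⟩, rfl⟩
    · exact ⟨isEmpty_GFM_equiv P hn2 hsum h1 h2 (hob.mpr h),
        isEmpty_standardModule_equiv P hn2 hsum h1 h2 (hob.mpr h)⟩
  · obtain ⟨l, q, hl, hl3, hq⟩ := exists_primitiveRoot k
    have h0 : q ≠ 0 := hq.ne_zero (by omega)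
    have h2 : q ^ 2 ≠ 1 := hq.pow_ne_one_of_pos_of_lt (by norm_num) (by omega)
    have h4 : q ^ 4 ≠ 1 := fun h => h2 <| by
      have hd := (hq.pow_eq_one_iff_dvd 4).mp h
      have hco : Nat.Coprime l (2 ^ 2) := (Nat.coprime_two_right.mpr hl).pow_right 2
      have := Nat.Coprime.eq_one_of_dvd hco hd
      omega
    have hd : q - q⁻¹ ≠ 0 := fun h => h2 <| by
      rw [sub_eq_zero] at h
      rw [pow_two]
      nth_rewrite 2 [h]
      exact mul_inv_cancel₀ h0
    -- With m = 2 the conditions on λ₁, λ₂ become q⁴ ≠ 1 and q² ≠ 1. Taking n₂ = 2 makes the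
    -- congruence an equality, and n ≥ 3 leaves n₁ = n − 2 > 0.
    let P : BlobParams k :=
      { q := q
        m := 2
        q_ne_zero := h0
        q_pow_four_ne_one := h4
        lam_ne := by
          rw [Ne, div_left_inj' hd, zpow_neg, ← mul_eq_one_iff_eq_inv₀ (zpow_ne_zero _ h0),
            ← zpow_add₀ h0]
          exact_mod_cast h4
        lam_ne_mul := by
          rw [mul_div_assoc', Ne, div_left_inj' hd, zpow_neg, zpow_ofNat,
            mul_inv_cancel₀ (pow_ne_zero 2 h0)]
          exact h2 }
    have hob := (ATY.obstruction_eq_zero_iff P hl hq 2).mpr rfl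
    exact ⟨P, l, n - 2, 2, _, hl, hq, by omega, rfl, by omega, by omega, rfl,
      isEmpty_GFM_equiv P hn2 (by omega) (by omega) two_pos hob,
      isEmpty_standardModule_equiv P hn2 (by omega) (by omega) two_pos hob⟩
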